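/- Let $\mathcal K$ be a tt-category: an (essentially small) idempotent complete triangulated category with a symmetric monoidal structure $(\otimes,\mathbb 1)$ whose tensor product is exact in each variable. Let $A=(A,\mu,\eta)$ be a tt-ring in $\mathcal K$, i.e. a commutative ring object whose multiplication $\mu:A\otimes A\to A$ has a section as a map of $A,A$-bimodules. The splitting tower $A^{[0]}\to A^{[1]}\to A^{[2]}\to\cdots$ of $A$ is characterized by $A^{[0]}=\mathbb 1$, $A^{[1]}=A$ and, for $n\ge 1$, the existence of an isomorphism of $A^{[n]}$-algebras $A^{[n]}\otimes_{A^{[n-1]}}A^{[n]}\cong A^{[n]}\times A^{[n+1]}$ whose first component is the multiplication; $\deg(A)=d$ means that $A^{[d]}\neq 0$ and $A^{[d+1]}=0$. Let $A\text{-}\mathrm{Mod}_{\mathcal K}$ be the category of $A$-modules in $\mathcal K$, with tensor product $\otimes_A$ and with the triangulation whose distinguished triangles are those that are distinguished in $\mathcal K$ after forgetting the action, and let $F_A=A\otimes-:\mathcal K\to A\text{-}\mathrm{Mod}_{\mathcal K}$ be the free module functor. For a tt-category $\mathcal L$, $\mathrm{Spc}(\mathcal L)$ is the set of prime ideals of $\mathcal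 L$ (proper thick triangulated $\otimes$-ideals $\mathcal P$ such that $x\otimes y\in\mathcal P$ implies $x\in\mathcal P$ or $y\in\mathcal P$), with the topology generated by the open sets $\{\mathcal P : x\in\mathcal P\}$, and $\mathrm{supp}(x)=\{\mathcal P : x\notin\mathcal P\}$. Then $\deg(A)=1$ if and only if $A\neq 0$ and $\mu$ is an isomorphism. Suppose that $\mu$ is an isomorphism. Then: 1. $L=A\otimes-:\mathcal K\to\mathcal K$ with $\eta\otimes-:\mathrm{Id}\to L$ is a Bousfield localization: $L$ is exact, $\eta\otimes-$ commutes with the shifts, and $L(\eta\otimes x)=\eta\otimes L(x)$ is an isomorphism for every $x$. 2. $F_A:\mathcal K\to A\text{-}\mathrm{Mod}_{\mathcal K}$ is a Verdier localization: it is the localization of $\mathcal K$ at the morphisms whose cone lies in $\ker(F_A)$, and the distinguished triangles of $A\text{-}\mathrm{Mod}_{\mathcal K}$ are exactly the triangles isomorphic to images of distinguished triangles of $\mathcal K$. 3. $\mathrm{supp}(A)$ is open and closed in $\mathrm{Spc}(\mathcal K)$, and $\mathcal Q\mapsto F_A^{-1}(\mathcal Q)$ is a homeomorphism from $\mathrm{Spc}(A\text{-}\mathrm{Mod}_{\mathcal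 K})$ onto $\mathrm{supp}(A)$. 4. If $\mathcal K$ is rigid (every object has a dual), then there are tt-categories $\mathcal K_1,\mathcal K_2$ and exact symmetric monoidal functors $\mathcal K\to\mathcal K_1$ and $\mathcal K\to\mathcal K_2$ that together form an equivalence $\mathcal K\simeq\mathcal K_1\times\mathcal K_2$, under which $A$ corresponds to $(\mathbb 1,0)$, with $A\mapsto\mathbb 1$ as rings in $\mathcal K_1$. -/

import Mathlib

open CategoryTheory MonoidalCategory Limits Pretriangulated MonObj

universe v u

/-- A tensor-triangulated category (tt-category): a triangulated category with a symmetric monoidal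
structure whose tensor product is exact in each variable, and which is idempotent complete.
Exactness is recorded for the functors `X ⊗ -`; it follows for `- ⊗ X` through the symmetry.
The exactness datum consists of the isomorphisms `X ⊗ Y⟦n⟧ ≅ (X ⊗ Y)⟦n⟧`, which are natural in
both variables and compatible with the associativity and unit constraints. -/
class TTCategory (K : Type u) [Category.{v} K] [Preadditive K] [HasZeroObject K] [HasShift K ℤ]
    [∀ n : ℤ, (shiftFunctor K n).Additive] [Pretriangulated K] [MonoidalCategory K]
    [SymmetricCategory K] where
  /-- the octahedral axiom -/
  isTriangulated : IsTriangulated K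
  isIdempotentComplete : IsIdempotentComplete K
  /-- the isomorphisms `X ⊗ Y⟦n⟧ ≅ (X ⊗ Y)⟦n⟧`, natural in `Y` -/
  commShift (X : K) : (tensorLeft X).CommShift ℤ
  /-- `X ⊗ -` preserves distinguished triangles -/
  exact (X : K) : (tensorLeft X).IsTriangulated
  /-- naturality in the first variable -/
  natural {X X' : K} (f : X ⟶ X') : NatTrans.CommShift ((tensoringLeft K).map f) ℤ
  /-- compatibility with the associator -/
  assoc (X Y : K) : NatTrans.CommShift (tensorLeftTensor X Y).hom ℤ
  /-- compatibility with the left unitor -/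
  unit : NatTrans.CommShift (leftUnitorNatIso K).hom ℤ

attribute [reducible] TTCategory.commShift

attribute [instance] TTCategory.isTriangulated TTCategory.isIdempotentComplete
  TTCategory.commShift TTCategory.exact TTCategory.natural TTCategory.assoc TTCategory.unit

namespace TT

section Spectrum

/-- The part of the structure of a tensor-triangulated category that its spectrum depends on:
the distinguished triangles and the relation "`Z` is a tensor product of `X` and `Y`". -/
structure TTData (C : Type u) [Category.{v} C] [HasShift C ℤ] where
  /-- the distinguished triangles -/
  dist : Set (Triangle C)
  /-- `IsTensor X Y Z` means that `Z` is (isomorphic to) the tensor product of `X` and `Y` -/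
  IsTensor : C → C → C → Prop

/-- A prime: a proper thick triangulated `⊗`-ideal `P` such that `X ⊗ Y ∈ P` implies
`X ∈ P` or `Y ∈ P`. -/
structure TTData.IsPrime {C : Type u} [Category.{v} C] [HasShift C ℤ] (D : TTData C)
    (P : ObjectProperty C) : Prop where
  zero : P.ContainsZero
  shift : P.IsStableUnderShift ℤ
  ext₁ : ∀ T ∈ D.dist, P T.obj₂ → P T.obj₃ → P T.obj₁
  ext₂ : ∀ T ∈ D.dist, P T.obj₁ → P T.obj₃ → P T.obj₂
  ext₃ : ∀ T ∈ D.dist, P T.obj₁ → P T.obj₂ → P T.obj₃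
  retract : P.IsStableUnderRetracts
  ideal : ∀ X Y Z : C, D.IsTensor X Y Z → P Y → P Z
  proper : ∃ X : C, ¬ P X
  prime : ∀ X Y Z : C, D.IsTensor X Y Z → P Z → P X ∨ P Y

/-- The spectrum, as a set: the primes. -/
def TTData.Spc {C : Type u} [Category.{v} C] [HasShift C ℤ] (D : TTData C) : Type u :=
  {P : ObjectProperty C // D.IsPrime P}

/-- The support of an object: the primes that do not contain it. -/
def TTData.supp {C : Type u} [Category.{v} C] [HasShift C ℤ] (D : TTData C) (X : C) :
    Set D.Spc :=
  {P | ¬ P.1 X}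

/-- The topology of the spectrum: it is generated by the complements of the supports. -/
instance {C : Type u} [Category.{v} C] [HasShift C ℤ] (D : TTData C) : TopologicalSpace D.Spc :=
  TopologicalSpace.generateFrom (Set.range fun X : C => (D.supp X)ᶜ)

end Spectrum

section ModuleBasics

variable {K : Type u} [Category.{v} K] [MonoidalCategory K] {A : K} [MonObj A]

/-- An isomorphism of modules from a linear isomorphism of the underlying objects. -/
def modIso {M N : Mod K A} (e : M.X ≅ N.X)
    (h : (ModObj.smul (M := A) (X := M.X) : A ⊗ M.X ⟶ M.X) ≫ e.hom =
      A ◁ e.hom ≫ (ModObj.smul (M := A) (X := N.X) : A ⊗ N.X ⟶ N.X)) : M ≅ N where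
  hom := Mod.Hom.mk' e.hom h
  inv := Mod.Hom.mk' e.inv (by
    change (ModObj.smul (M := A) (X := N.X) : A ⊗ N.X ⟶ N.X) ≫ e.inv =
      A ◁ e.inv ≫ (ModObj.smul (M := A) (X := M.X) : A ⊗ M.X ⟶ M.X)
    rw [Iso.comp_inv_eq, Category.assoc, h, MonoidalCategory.whiskerLeft_inv_hom_assoc])
  hom_inv_id := by ext; exact e.hom_inv_id
  inv_hom_id := by ext; exact e.inv_hom_id

@[simp]
lemma modIso_hom_hom {M N : Mod K A} (e : M.X ≅ N.X) (h) :
    (modIso (M := M) (N := N) e h).hom.hom = e.hom := rfl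

@[simp]
lemma modIso_inv_hom {M N : Mod K A} (e : M.X ≅ N.X) (h) :
    (modIso (M := M) (N := N) e h).inv.hom = e.inv := rfl

lemma eqToHom_hom {M N : Mod K A} (h : M = N) :
    (eqToHom h).hom = eqToHom (congrArg Mod.X h) := by
  subst h; rfl

end ModuleBasics

section

variable (K : Type u) [Category.{v} K] [Preadditive K] [HasZeroObject K] [HasShift K ℤ]
  [∀ n : ℤ, (shiftFunctor K n).Additive] [Pretriangulated K] [MonoidalCategory K]
  [SymmetricCategory K]

/-- The data of a tt-category `K` itself. -/
def selfData : TTData K where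
  dist := distTriang K
  IsTensor X Y Z := Nonempty (Z ≅ X ⊗ Y)

variable {K}

/-- Separability of a ring object: the multiplication has a section of bimodules. -/
def IsSeparable (A : K) [MonObj A] : Prop :=
  ∃ σ : A ⟶ A ⊗ A, σ ≫ μ[A] = 𝟙 A ∧
    μ[A] ≫ σ = A ◁ σ ≫ (α_ A A A).inv ≫ μ[A] ▷ A ∧
    μ[A] ≫ σ = σ ▷ A ≫ (α_ A A A).hom ≫ A ◁ μ[A]

/-- A splitting tower `A⁽⁰⁾ = 𝟙 → A⁽¹⁾ = A → A⁽²⁾ → ⋯` of a commutative ring object `A`: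
for `n ≥ 1` there is an isomorphism of `A⁽ⁿ⁾`-algebras from `A⁽ⁿ⁾ ⊗ A⁽ⁿ⁾` (tensor over `A⁽ⁿ⁻¹⁾`)
to `A⁽ⁿ⁾ × A⁽ⁿ⁺¹⁾` whose first component is the multiplication. The relative tensor product of
commutative rings is their pushout in commutative ring objects, with `i`, `j` the two canonical
maps, and the multiplication is the codiagonal map `p`. -/
structure SplittingTower (A : CommMon K) where
  /-- the rings in the tower -/
  ring : ℕ → CommMon K
  /-- the transition maps -/
  map (n : ℕ) : ring n ⟶ ring (n + 1)
  ring_zero : Nonempty (ring 0 ≅ CommMon.trivial K)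
  ring_one : Nonempty (ring 1 ≅ A)
  split (n : ℕ) : ∃ (B : CommMon K) (i j : ring (n + 1) ⟶ B) (p : B ⟶ ring (n + 1))
    (q : B ⟶ ring (n + 2)), IsPushout (map n) (map n) i j ∧ i ≫ p = 𝟙 _ ∧ j ≫ p = 𝟙 _ ∧
      i ≫ q = map (n + 1) ∧ Nonempty (IsLimit (BinaryFan.mk p q))

/-- `A` has finite degree `d`: `A⁽ᵈ⁾ ≠ 0` and `A⁽ᵈ⁺¹⁾ = 0` (the tower of a separable `A` exists
and is unique up to isomorphism). -/
def HasDegree (A : CommMon K) (d : ℕ) : Prop :=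
  ∃ T : SplittingTower A, ¬ IsZero (T.ring d).X ∧ IsZero (T.ring (d + 1)).X

/-- `L` with `e : 𝟭 ⟶ L` is a Bousfield localization: `L` is exact and `Le = eL` is invertible. -/
structure IsBousfieldLocalization (L : K ⥤ K) [L.CommShift ℤ] (e : 𝟭 K ⟶ L) : Prop where
  exact : L.IsTriangulated
  commShift : NatTrans.CommShift e ℤ
  map_eq (X : K) : L.map (e.app X) = e.app (L.obj X)
  isIso (X : K) : IsIso (L.map (e.app X))

/-- `F : K ⥤ D` is a Verdier localization, for a class `dist` of triangles in `D`: it is the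
localization of `K` at the morphisms whose cone lies in the kernel of `F`, and the triangles in
`dist` are those isomorphic to the image of a distinguished triangle of `K`. So `D` is the
Verdier quotient of `K` by the kernel of `F`. -/
structure IsVerdierLocalization {D : Type*} [Category* D] [HasShift D ℤ] (F : K ⥤ D)
    [F.CommShift ℤ] (dist : Set (Triangle D)) : Prop where
  isLocalization : F.IsLocalization (ObjectProperty.trW fun X : K => IsZero (F.obj X))
  dist_eq : dist = F.essImageDistTriang

variable [TTCategory K]

/-- The natural transformation `η ⊗ - : 𝟭 ⟶ A ⊗ -` given by the unit of `A`. -/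
def unitTrans (A : K) [MonObj A] : 𝟭 K ⟶ tensorLeft A :=
  (leftUnitorNatIso K).inv ≫ (tensoringLeft K).map η[A]

section Shift

/-- The isomorphism `X ⊗ Y⟦n⟧ ≅ (X ⊗ Y)⟦n⟧`. -/
def tensorShift (X Y : K) (n : ℤ) : X ⊗ Y⟦n⟧ ≅ (X ⊗ Y)⟦n⟧ :=
  ((tensorLeft X).commShiftIso n).app Y

lemma tensorShift_natural_left {X X' : K} (f : X ⟶ X') (Y : K) (n : ℤ) :
    f ▷ Y⟦n⟧ ≫ (tensorShift X' Y n).hom = (tensorShift X Y n).hom ≫ (f ▷ Y)⟦n⟧' :=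
  (NatTrans.shift_app_comm ((tensoringLeft K).map f) n Y).symm

lemma tensorShift_natural_right (X : K) {Y Y' : K} (f : Y ⟶ Y') (n : ℤ) :
    X ◁ f⟦n⟧' ≫ (tensorShift X Y' n).hom = (tensorShift X Y n).hom ≫ (X ◁ f)⟦n⟧' :=
  (tensorLeft X).commShiftIso_hom_naturality f n

lemma tensorShift_unit (Y : K) (n : ℤ) :
    (tensorShift (𝟙_ K) Y n).hom ≫ (λ_ Y).hom⟦n⟧' = (λ_ (Y⟦n⟧)).hom := by
  have := NatTrans.shift_app_comm (leftUnitorNatIso K).hom n Y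
  simpa [tensorShift] using this

lemma tensorShift_assoc (X Y Z : K) (n : ℤ) :
    (tensorShift (X ⊗ Y) Z n).hom ≫ (α_ X Y Z).hom⟦n⟧' =
      (α_ X Y (Z⟦n⟧)).hom ≫ X ◁ (tensorShift Y Z n).hom ≫ (tensorShift X (Y ⊗ Z) n).hom := by
  have := NatTrans.shift_app_comm (tensorLeftTensor X Y).hom n Z
  simpa [tensorShift, Functor.commShiftIso_comp_hom_app] using this

end Shift

section Modules

variable {A : K} [MonObj A]

/-- The action of `A` on `X⟦n⟧` for an `A`-module `X`: `A ⊗ X⟦n⟧ ≅ (A ⊗ X)⟦n⟧ ⟶ X⟦n⟧`. -/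
abbrev shiftModObj (X : K) [ModObj A X] (n : ℤ) : ModObj A (X⟦n⟧) where
  smul := (tensorShift A X n).hom ≫ (ModObj.smul (M := A) (X := X) : A ⊗ X ⟶ X)⟦n⟧'
  one_smul := by
    change η[A] ▷ X⟦n⟧ ≫ (tensorShift A X n).hom ≫ _ = (λ_ (X⟦n⟧)).hom
    rw [← Category.assoc, tensorShift_natural_left, Category.assoc, ← Functor.map_comp,
      ModObj.one_smul_self, tensorShift_unit]
  mul_smul := by
    change μ[A] ▷ X⟦n⟧ ≫ (tensorShift A X n).hom ≫ _ = (α_ A A (X⟦n⟧)).hom ≫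
      A ◁ ((tensorShift A X n).hom ≫ _) ≫ (tensorShift A X n).hom ≫ _
    rw [← Category.assoc, tensorShift_natural_left, Category.assoc, ← Functor.map_comp,
      ModObj.mul_smul_self, MonoidalCategory.whiskerLeft_comp, Functor.map_comp, Functor.map_comp,
      Category.assoc, reassoc_of% (tensorShift_natural_right A), reassoc_of% (tensorShift_assoc A)]

variable (A) in
/-- The shift functors on `A`-modules. -/
def modShift (n : ℤ) : Mod K A ⥤ Mod K A where
  obj M := letI := shiftModObj (A := A) M.X n; ⟨M.X⟦n⟧⟩
  map {M N} f := letI := shiftModObj (A := A) M.X n; letI := shiftModObj (A := A) N.X n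
    Mod.Hom.mk'' (f.hom⟦n⟧') (by
      change ((tensorShift A M.X n).hom ≫ _) ≫ _ = A ◁ f.hom⟦n⟧' ≫ (tensorShift A N.X n).hom ≫ _
      rw [reassoc_of% (tensorShift_natural_right A), Category.assoc, ← Functor.map_comp,
        ← Functor.map_comp, IsModHom.smul_hom (A := A) (f := f.hom)]
      rfl)

lemma tensorShift_zero (X Y : K) :
    (tensorShift X Y 0).hom ≫ ((shiftFunctorZero K ℤ).hom.app (X ⊗ Y)) =
      X ◁ (shiftFunctorZero K ℤ).hom.app Y := by
  have h := (tensorLeft X).commShiftIso_zero ℤ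
  simp [tensorShift, h]

lemma tensorShift_add (X Y : K) (m n : ℤ) :
    (tensorShift X Y (m + n)).hom ≫ (shiftFunctorAdd K m n).hom.app (X ⊗ Y) =
      X ◁ (shiftFunctorAdd K m n).hom.app Y ≫ (tensorShift X (Y⟦m⟧) n).hom ≫
        (tensorShift X Y m).hom⟦n⟧' := by
  have h := (tensorLeft X).commShiftIso_add m n
  simp [tensorShift, h]

variable (A) in
/-- `A`-modules carry the shift of the underlying objects. -/
noncomputable instance : HasShift (Mod K A) ℤ := hasShiftMk _ _
  { F := modShift A
    zero := NatIso.ofComponents (fun M => modIso ((shiftFunctorZero K ℤ).app M.X) (by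
      change ((tensorShift A M.X 0).hom ≫ _) ≫ (shiftFunctorZero K ℤ).hom.app M.X = _
      rw [Category.assoc, NatTrans.naturality, reassoc_of% (tensorShift_zero A)]
      rfl)) (fun f => by ext; exact (shiftFunctorZero K ℤ).hom.naturality f.hom)
    add := fun m n => NatIso.ofComponents
      (fun M => modIso ((shiftFunctorAdd K m n).app M.X) (by
        change ((tensorShift A M.X (m + n)).hom ≫ _) ≫ (shiftFunctorAdd K m n).hom.app M.X =
          A ◁ (shiftFunctorAdd K m n).hom.app M.X ≫ (tensorShift A (M.X⟦m⟧) n).hom ≫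
            ((tensorShift A M.X m).hom ≫ _)⟦n⟧'
        rw [Category.assoc, NatTrans.naturality, reassoc_of% (tensorShift_add A), Functor.map_comp]
        rfl)) (fun f => by ext; exact (shiftFunctorAdd K m n).hom.naturality f.hom)
    assoc_hom_app := fun m₁ m₂ m₃ M => by
      ext
      have h := shiftFunctorAdd_assoc_hom_app m₁ m₂ m₃ M.X
      simp only [shiftFunctorAdd', Iso.trans_hom, NatTrans.comp_app, eqToIso.hom, eqToHom_app,
        Category.assoc] at h
      simp only [Mod.comp_hom', eqToHom_hom]
      exact h
    zero_add_hom_app := fun n M => by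
      ext
      simp only [Mod.comp_hom', eqToHom_hom]
      exact shiftFunctorAdd_zero_add_hom_app n M.X
    add_zero_hom_app := fun n M => by
      ext
      simp only [Mod.comp_hom', eqToHom_hom]
      exact shiftFunctorAdd_add_zero_hom_app n M.X }

lemma modShift_obj_X (M : Mod K A) (n : ℤ) : (M⟦n⟧).X = M.X⟦n⟧ := rfl

variable (A) in
/-- The forgetful functor `U_A : A-Mod ⥤ K` commutes with the shifts on the nose. -/
noncomputable instance : (Mod.forget A : Mod K A ⥤ K).CommShift ℤ where
  commShiftIso n := NatIso.ofComponents (fun M => Iso.refl (M.X⟦n⟧)) (fun f => by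
    exact (Category.comp_id _).trans (Category.id_comp _).symm)
  commShiftIso_zero := by
    ext M
    rw [Functor.CommShift.isoZero_hom_app]
    change 𝟙 _ = (shiftFunctorZero K ℤ).hom.app M.X ≫ (shiftFunctorZero K ℤ).inv.app M.X
    exact (Iso.hom_inv_id_app _ _).symm
  commShiftIso_add m n := by
    ext M
    rw [Functor.CommShift.isoAdd_hom_app]
    change 𝟙 _ = (shiftFunctorAdd K m n).hom.app M.X ≫ 𝟙 _ ≫ (shiftFunctor K n).map (𝟙 _) ≫
      (shiftFunctorAdd K m n).inv.app M.X
    rw [CategoryTheory.Functor.map_id, Category.id_comp]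
    erw [Category.id_comp]
    exact (Iso.hom_inv_id_app _ _).symm

/-- The action of `A` on the free module `A ⊗ X`. -/
abbrev freeModObj (A : K) [MonObj A] (X : K) : ModObj A (A ⊗ X) where
  smul := (α_ A A X).inv ≫ μ[A] ▷ X
  one_smul := by
    change η[A] ▷ (A ⊗ X) ≫ (α_ A A X).inv ≫ μ[A] ▷ X = (λ_ (A ⊗ X)).hom
    rw [associator_inv_naturality_left_assoc, ← comp_whiskerRight, MonObj.one_mul,
      leftUnitor_tensor_hom]
  mul_smul := by
    change μ[A] ▷ (A ⊗ X) ≫ (α_ A A X).inv ≫ μ[A] ▷ X = (α_ A A (A ⊗ X)).hom ≫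
      A ◁ ((α_ A A X).inv ≫ μ[A] ▷ X) ≫ (α_ A A X).inv ≫ μ[A] ▷ X
    rw [associator_inv_naturality_left_assoc, ← comp_whiskerRight, MonObj.mul_assoc]
    simp

/-- The free module functor (extension of scalars) `F_A : K ⥤ A-Mod`, `X ↦ A ⊗ X`. -/
def freeFunctor (A : K) [MonObj A] : K ⥤ Mod K A where
  obj X := letI := freeModObj A X; ⟨A ⊗ X⟩
  map {X Y} f := letI := freeModObj A X; letI := freeModObj A Y
    Mod.Hom.mk'' (A ◁ f) (by
      change ((α_ A A X).inv ≫ μ[A] ▷ X) ≫ A ◁ f = A ◁ A ◁ f ≫ (α_ A A Y).inv ≫ μ[A] ▷ Y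
      rw [Category.assoc, ← whisker_exchange, associator_inv_naturality_right_assoc])
  map_id X := by ext; exact MonoidalCategory.whiskerLeft_id A X
  map_comp f g := by ext; exact MonoidalCategory.whiskerLeft_comp A f g

/-- The free module functor commutes with the shifts, through `A ⊗ X⟦n⟧ ≅ (A ⊗ X)⟦n⟧`. -/
noncomputable instance (A : K) [MonObj A] : (freeFunctor A).CommShift ℤ where
  commShiftIso n := NatIso.ofComponents (fun X => modIso (tensorShift A X n) (by
      change ((α_ A A (X⟦n⟧)).inv ≫ μ[A] ▷ X⟦n⟧) ≫ (tensorShift A X n).hom =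
        A ◁ (tensorShift A X n).hom ≫ (tensorShift A (A ⊗ X) n).hom ≫
          ((α_ A A X).inv ≫ μ[A] ▷ X)⟦n⟧'
      rw [Category.assoc, tensorShift_natural_left, Iso.inv_comp_eq, Functor.map_comp,
        ← reassoc_of% (tensorShift_assoc A A X n), Iso.map_hom_inv_id_assoc]))
    (fun f => by ext; exact tensorShift_natural_right A f n)
  commShiftIso_zero := by
    ext X
    rw [Functor.CommShift.isoZero_hom_app]
    change (tensorShift A X 0).hom =
      A ◁ (shiftFunctorZero K ℤ).hom.app X ≫ (shiftFunctorZero K ℤ).inv.app (A ⊗ X)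
    rw [← tensorShift_zero, Category.assoc, Iso.hom_inv_id_app]
    exact (Category.comp_id _).symm
  commShiftIso_add m n := by
    ext X
    rw [Functor.CommShift.isoAdd_hom_app]
    change (tensorShift A X (m + n)).hom = A ◁ (shiftFunctorAdd K m n).hom.app X ≫
      (tensorShift A (X⟦m⟧) n).hom ≫ (tensorShift A X m).hom⟦n⟧' ≫
        (shiftFunctorAdd K m n).inv.app (A ⊗ X)
    rw [← reassoc_of% (tensorShift_add A X m n), Iso.hom_inv_id_app]
    exact (Category.comp_id _).symm

/-- The right action of a commutative ring `A` on an `A`-module. -/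
def rightAction (A : K) [MonObj A] (M : Mod K A) : M.X ⊗ A ⟶ M.X :=
  (β_ M.X A).hom ≫ (ModObj.smul (M := A) (X := M.X) : A ⊗ M.X ⟶ M.X)

/-- `T` is a tensor product over `A` of the `A`-modules `M` and `N`: it is the coequalizer of the
two actions `M ⊗ A ⊗ N ⇉ M ⊗ N`, with the action induced by that on `M`. -/
def IsTensorOver (A : K) [MonObj A] (M N T : Mod K A) : Prop :=
  ∃ (q : M.X ⊗ N.X ⟶ T.X)
    (w : rightAction A M ▷ N.X ≫ q =
      ((α_ M.X A N.X).hom ≫ M.X ◁ (ModObj.smul (M := A) (X := N.X) : A ⊗ N.X ⟶ N.X)) ≫ q),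
    Nonempty (IsColimit (Cofork.ofπ q w)) ∧
    A ◁ q ≫ (ModObj.smul (M := A) (X := T.X) : A ⊗ T.X ⟶ T.X) =
      (α_ A M.X N.X).inv ≫ (ModObj.smul (M := A) (X := M.X) : A ⊗ M.X ⟶ M.X) ▷ N.X ≫ q

/-- The tt-structure of `A-Mod`: the triangulation is the one for which a triangle is distinguished
if and only if its image under the forgetful functor is (the only one for which the free module
functor and the forgetful functor are exact), and the tensor product is the one over `A`. -/
noncomputable def modData (A : K) [MonObj A] : TTData (Mod K A) where
  dist := {T | (Mod.forget A : Mod K A ⥤ K).mapTriangle.obj T ∈ distTriang K}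
  IsTensor := IsTensorOver A

end Modules


end

section Products

/-- A tt-functor: an exact symmetric (strong) monoidal functor, whose isomorphisms with the shifts
and with the tensor products are compatible. -/
structure TTFunctor (K : Type u) [Category.{v} K] [Preadditive K] [HasZeroObject K] [HasShift K ℤ]
    [∀ n : ℤ, (shiftFunctor K n).Additive] [Pretriangulated K] [MonoidalCategory K]
    [SymmetricCategory K] [TTCategory K]
    (L : Type u) [Category.{v} L] [Preadditive L] [HasZeroObject L] [HasShift L ℤ]
    [∀ n : ℤ, (shiftFunctor L n).Additive] [Pretriangulated L] [MonoidalCategory L]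
    [SymmetricCategory L] [TTCategory L] where
  /-- the underlying functor -/
  functor : K ⥤ L
  [braided : functor.Braided]
  [commShift : functor.CommShift ℤ]
  exact : functor.IsTriangulated
  compat (X Y : K) (n : ℤ) :
    functor.obj X ◁ (functor.commShiftIso n).hom.app Y ≫
        (tensorShift (functor.obj X) (functor.obj Y) n).hom ≫
        (Functor.LaxMonoidal.μ functor X Y)⟦n⟧' =
      Functor.LaxMonoidal.μ functor X (Y⟦n⟧) ≫ functor.map (tensorShift X Y n).hom ≫
        (functor.commShiftIso n).hom.app (X ⊗ Y)

attribute [instance] TTFunctor.braided TTFunctor.commShift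

/-- A bundled tt-category. -/
structure TTCat where
  /-- the objects -/
  carrier : Type u
  [category : Category.{v} carrier]
  [preadditive : Preadditive carrier]
  [hasZeroObject : HasZeroObject carrier]
  [hasShift : HasShift carrier ℤ]
  [additive : ∀ n : ℤ, (shiftFunctor carrier n).Additive]
  [pretriangulated : Pretriangulated carrier]
  [monoidal : MonoidalCategory carrier]
  [symmetric : SymmetricCategory carrier]
  [tt : TTCategory carrier]

attribute [instance] TTCat.category TTCat.preadditive TTCat.hasZeroObject TTCat.hasShift
  TTCat.additive TTCat.pretriangulated TTCat.monoidal TTCat.symmetric TTCat.tt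

end Products

end TT

set_option linter.unusedSectionVars false

/-! For a commutative ring `A`, the multiplication is invertible exactly when `a ↦ a ⊗ 1` and `a ↦ 1
⊗ a` agree, that is, when `𝟙 ⟶ A` is an epimorphism of commutative rings. If `A⁽²⁾ = 0`, the
splitting of `A⁽¹⁾ ⊗ A⁽¹⁾` makes the codiagonal monic, so the two pushout legs agree and `𝟙 ⟶ A` is
such an epimorphism. Conversely `𝟙 ⟶ A ⟶ 0 ⟶ ⋯` is a splitting tower.

Once `μ` is invertible, every action `A ⊗ X ⟶ X` is inverse to the natural map `η ⊗ X`
(`isIso_smul`). Hence all morphisms between modules are linear, the forgetful functor is fully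
faithful, and its left adjoint `F_A` is a localization; `trW_ker_eq` identifies the inverted
morphisms by their cones. The two actions on `M ⊗ A ⊗ N` coincide, so the tensor product over `A` is
the one of `K` (`isTensorOver_iff`), and primes move back and forth along `F_A` and the forgetful
functor.

The cone `C` of `η` satisfies `A ⊗ C = 0`. A prime therefore contains `A` or `C`, but not both,
which makes the support of `A` clopen. If `A` has a dual, `A ⊗ C = 0` kills the map `A ⟶ C`, so `A`
is a summand of `𝟙`. The resulting idempotent of `𝟙` acts on every object compatibly with all
structure and splits `K` into two quotients (`isEquivalence_prod'`). -/

namespace TT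

/-! ### Commutative monoids with invertible multiplication -/

section CommutativeMonoids

variable {C : Type u} [Category.{v} C] [MonoidalCategory C]

/-- If `x ↦ x ⊗ 1` and `x ↦ 1 ⊗ x` agree, then the multiplication is invertible. -/
lemma isIso_mul_of_inclusions_eq (A : C) [MonObj A]
    (h : (ρ_ A).inv ≫ A ◁ η[A] = (λ_ A).inv ≫ η[A] ▷ A) : IsIso μ[A] := by
  refine ⟨(ρ_ A).inv ≫ A ◁ η[A], ?_, by simp⟩
  -- Left linearity: `ab ⊗ 1 = a · (b ⊗ 1)`. Replacing `b ⊗ 1` by `1 ⊗ b` then gives `a · (1 ⊗ b) =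
  -- a ⊗ b`, which is `h₂`.
  have h₁ : μ[A] ≫ (ρ_ A).inv ≫ A ◁ η[A] =
      A ◁ ((ρ_ A).inv ≫ A ◁ η[A]) ≫ (α_ A A A).inv ≫ μ[A] ▷ A := by
    rw [MonoidalCategory.whiskerLeft_comp, Category.assoc,
      associator_inv_naturality_right_assoc, whisker_exchange]
    simp
  have h₂ : A ◁ ((λ_ A).inv ≫ η[A] ▷ A) ≫ (α_ A A A).inv ≫ μ[A] ▷ A = 𝟙 _ := by
    rw [MonoidalCategory.whiskerLeft_comp, Category.assoc,
      associator_inv_naturality_middle_assoc, ← comp_whiskerRight, MonObj.mul_one]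
    simp
  rw [h₁, h, h₂]

/-- Both maps are sections of `μ`. -/
lemma inclusions_eq_of_isIso_mul (A : C) [MonObj A] [IsIso μ[A]] :
    (ρ_ A).inv ≫ A ◁ η[A] = (λ_ A).inv ≫ η[A] ▷ A := by
  rw [← cancel_mono μ[A]]
  simp

lemma isIso_mul_of_iso {X Y : C} [MonObj X] [MonObj Y] (e : X ≅ Y) [IsMonHom e.hom]
    [IsIso μ[X]] : IsIso μ[Y] := by
  have h : μ[Y] = (e.inv ⊗ₘ e.inv) ≫ μ[X] ≫ e.hom := by
    rw [IsMonHom.mul_hom, tensorHom_comp_tensorHom_assoc]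
    simp
  rw [h]
  infer_instance

lemma isMonHom_one (X : C) [MonObj X] : IsMonHom η[X] where
  one_hom := by simp
  mul_hom := by
    have : (η[X] ⊗ₘ η[X]) ≫ μ[X] = (λ_ (𝟙_ C)).hom ≫ η[X] := by
      rw [tensorHom_def', Category.assoc, MonObj.one_mul, leftUnitor_naturality]
    simpa using this.symm

attribute [local instance] isMonHom_one

variable [SymmetricCategory C]

/-- The inclusion `x ↦ x ⊗ 1`. -/
def inclusionLeft (A : CommMon C) : A ⟶ ⟨A.X ⊗ A.X⟩ :=
  CommMon.homMk (A := A) (B := ⟨A.X ⊗ A.X⟩)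
    (.mk (M := ⟨A.X⟩) (N := ⟨A.X ⊗ A.X⟩) ((ρ_ A.X).inv ≫ (𝟙 A.X ⊗ₘ η[A.X])))

/-- The inclusion `x ↦ 1 ⊗ x`. -/
def inclusionRight (A : CommMon C) : A ⟶ ⟨A.X ⊗ A.X⟩ :=
  CommMon.homMk (A := A) (B := ⟨A.X ⊗ A.X⟩)
    (.mk (M := ⟨A.X⟩) (N := ⟨A.X ⊗ A.X⟩) ((λ_ A.X).inv ≫ (η[A.X] ⊗ₘ 𝟙 A.X)))

/-- The multiplication is invertible if the unit is an epimorphism of commutative monoids. -/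
lemma isIso_mul_of_subsingleton_hom (A : CommMon C) (h : ∀ B : CommMon C, Subsingleton (A ⟶ B)) :
    IsIso μ[A.X] := by
  apply isIso_mul_of_inclusions_eq
  have : (ρ_ A.X).inv ≫ (𝟙 A.X ⊗ₘ η[A.X]) = (λ_ A.X).inv ≫ (η[A.X] ⊗ₘ 𝟙 A.X) :=
    congrArg (fun f => f.hom.hom) ((h _).elim (inclusionLeft A) (inclusionRight A))
  simpa using this

/-- Restricting `a ⊗ b ↦ f(a)g(b)` along the two inclusions `X ⟶ X ⊗ X` recovers `f` and `g`, and
these inclusions agree. -/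
lemma monHom_eq_of_isIso_mul {X Y : C} [MonObj X] [MonObj Y] [IsIso μ[X]] (f g : X ⟶ Y)
    [IsMonHom f] [IsMonHom g] : f = g := by
  have h : ∀ (f g : X ⟶ Y) [IsMonHom f] [IsMonHom g],
      ((ρ_ X).inv ≫ X ◁ η[X]) ≫ (f ⊗ₘ g) ≫ μ[Y] = f := fun f g _ _ => by
    rw [tensorHom_def', Category.assoc, Category.assoc, ← whiskerLeft_comp_assoc,
      IsMonHom.one_hom, whisker_exchange_assoc, MonObj.mul_one, rightUnitor_naturality,
      Iso.inv_hom_id_assoc]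
  have h' : ((λ_ X).inv ≫ η[X] ▷ X) ≫ (f ⊗ₘ g) ≫ μ[Y] = g := by
    rw [MonoidalCategory.tensorHom_def, Category.assoc, Category.assoc, ← comp_whiskerRight_assoc,
      IsMonHom.one_hom, ← whisker_exchange_assoc, MonObj.one_mul, leftUnitor_naturality,
      Iso.inv_hom_id_assoc]
  rw [← h f g, inclusions_eq_of_isIso_mul, h']

/-- If the multiplication is invertible, the unit is an epimorphism of commutative monoids. -/
lemma subsingleton_hom_of_isIso_mul (A : CommMon C) [IsIso μ[A.X]] (B : CommMon C) :
    Subsingleton (A ⟶ B) := by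
  refine ⟨fun f g => ?_⟩
  ext
  have : IsMonHom (M := A.X) (N := B.X) f.hom.hom := f.hom.isMonHom_hom
  have : IsMonHom (M := A.X) (N := B.X) g.hom.hom := g.hom.isMonHom_hom
  exact monHom_eq_of_isIso_mul (X := A.X) (Y := B.X) f.hom.hom g.hom.hom

/-- This plays the role of `A ⊗ A ≅ A` in the tower built below. -/
lemma isPushout_id_of_subsingleton_hom {D : Type*} [Category* D] {X Y : D} (f : X ⟶ Y)
    (h : ∀ Z : D, Subsingleton (Y ⟶ Z)) : IsPushout f f (𝟙 Y) (𝟙 Y) :=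
  IsPushout.of_isColimit' ⟨rfl⟩ (PushoutCocone.IsColimit.mk _ (fun s => s.inl)
    (fun _ => Category.id_comp _) (fun _ => (h _).elim _ _) (fun _ _ _ _ => (h _).elim _ _))

section Zero

/-- A zero object, as a commutative monoid. -/
noncomputable abbrev zeroCommMon {Z : C} (hZ : IsZero Z) : CommMon C :=
  letI : MonObj Z := {
    one := hZ.from_ _
    mul := hZ.from_ _
    one_mul := hZ.eq_of_tgt _ _
    mul_one := hZ.eq_of_tgt _ _
    mul_assoc := hZ.eq_of_tgt _ _ }
  { X := Z, comm := ⟨hZ.eq_of_tgt _ _⟩ }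

/-- A commutative monoid with vanishing underlying object is terminal. -/
noncomputable def isTerminalOfIsZero {A : CommMon C} (hA : IsZero A.X) : IsTerminal A :=
  IsTerminal.ofUniqueHom
    (fun B => CommMon.homMk (A := B) (B := A)
      (letI : IsMonHom (hA.from_ B.X) := ⟨hA.eq_of_tgt _ _, hA.eq_of_tgt _ _⟩
       .mk (M := ⟨B.X⟩) (N := ⟨A.X⟩) (hA.from_ B.X)))
    (fun B m => by ext; exact hA.eq_of_tgt _ _)

lemma subsingleton_hom_of_isZero {A : CommMon C} (hA : IsZero A.X) (B : CommMon C) :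
    Subsingleton (A ⟶ B) :=
  ⟨fun f g => by ext; exact hA.eq_of_src _ _⟩

lemma nonempty_isLimit_id {A B : CommMon C} (hB : IsZero B.X) (q : A ⟶ B) :
    Nonempty (IsLimit (BinaryFan.mk (𝟙 A) q)) :=
  ⟨BinaryFan.isLimitMk (fun s => s.fst) (fun s => Category.comp_id _)
    (fun s => (isTerminalOfIsZero hB).hom_ext _ _) (fun s m h _ => by simpa using h)⟩

lemma isZero_of_commMon_iso {A B : CommMon C} (e : A ≅ B) (h : IsZero A.X) : IsZero B.X :=
  h.of_iso ((CommMon.forget C).mapIso e).symm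

end Zero

end CommutativeMonoids

/-! ### Degree one and the splitting tower -/

section Degree

variable {K : Type u} [Category.{v} K] [Preadditive K] [HasShift K ℤ] [MonoidalCategory K]
  [SymmetricCategory K]

/-- When the second factor of the product is zero, the codiagonal is monic, so both pushout legs
coincide. Any two maps out of `ring 1` agree on the initial ring `ring 0`, hence factor through the
pushout and are equal. -/
lemma SplittingTower.subsingleton_hom {A : CommMon K} (T : SplittingTower A)
    (h : IsZero (T.ring 2).X) (B : CommMon K) : Subsingleton (T.ring 1 ⟶ B) := by
  obtain ⟨P, i, j, p, q, hP, hi, hj, -, ⟨hl⟩⟩ := T.split 0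
  refine ⟨fun f g => ?_⟩
  have hp : Mono p := ⟨fun a b hab => BinaryFan.IsLimit.hom_ext hl hab
    ((isTerminalOfIsZero h).hom_ext _ _)⟩
  have hij : i = j := by rw [← cancel_mono p, hi, hj]
  obtain ⟨e⟩ := T.ring_zero
  have w : T.map 0 ≫ f = T.map 0 ≫ g := by
    rw [← cancel_epi e.inv]
    exact Subsingleton.elim _ _
  calc f = i ≫ hP.desc f g w := (hP.inl_desc f g w).symm
    _ = j ≫ hP.desc f g w := congrArg (· ≫ hP.desc f g w) hij
    _ = g := hP.inr_desc f g w

variable [HasZeroObject K]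

open ZeroObject in
/-- The splitting tower `𝟙 ⟶ A ⟶ 0 ⟶ 0 ⟶ ⋯` of a commutative monoid whose multiplication is
invertible. -/
noncomputable def splittingTowerOfIsIso (A : CommMon K) [IsIso μ[A.X]] : SplittingTower A where
  ring
    | 0 => CommMon.trivial K
    | 1 => A
    | _ + 2 => zeroCommMon (isZero_zero K)
  map
    | 0 => default
    | 1 => (isTerminalOfIsZero (A := zeroCommMon (isZero_zero K)) (isZero_zero K)).from A
    | _ + 2 => 𝟙 _
  ring_zero := ⟨Iso.refl _⟩
  ring_one := ⟨Iso.refl _⟩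
  split
    -- The pushout of `𝟙 ⟶ A` along itself is `A`, which leaves the zero ring as the complementary
    -- factor.
    | 0 => ⟨A, 𝟙 A, 𝟙 A, 𝟙 A, _, isPushout_id_of_subsingleton_hom _
        (subsingleton_hom_of_isIso_mul A), Category.id_comp _, Category.id_comp _,
        Category.id_comp _, nonempty_isLimit_id (isZero_zero K) _⟩
    | 1 => ⟨_, 𝟙 _, 𝟙 _, 𝟙 _, _, isPushout_id_of_subsingleton_hom _
        (subsingleton_hom_of_isZero (isZero_zero K)), Category.id_comp _, Category.id_comp _,
        Category.id_comp _, nonempty_isLimit_id (isZero_zero K) _⟩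
    | _ + 2 => ⟨_, 𝟙 _, 𝟙 _, 𝟙 _, _, isPushout_id_of_subsingleton_hom _
        (subsingleton_hom_of_isZero (isZero_zero K)), Category.id_comp _, Category.id_comp _,
        Category.id_comp _, nonempty_isLimit_id (isZero_zero K) _⟩

lemma hasDegree_one_iff (A : CommMon K) :
    HasDegree A 1 ↔ ¬ IsZero A.X ∧ IsIso μ[A.X] := by
  constructor
  · rintro ⟨T, h₁, h₂⟩
    obtain ⟨e⟩ := T.ring_one
    have := isIso_mul_of_subsingleton_hom _ (T.subsingleton_hom h₂)
    have : IsMonHom (M := (T.ring 1).X) (N := A.X) ((CommMon.forget K).mapIso e).hom :=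
      e.hom.hom.isMonHom_hom
    exact ⟨fun h => h₁ (isZero_of_commMon_iso e.symm h), 
      isIso_mul_of_iso (X := (T.ring 1).X) (Y := A.X) ((CommMon.forget K).mapIso e)⟩
  · rintro ⟨h₁, h₂⟩
    exact ⟨splittingTowerOfIsIso A, h₁, isZero_zero K⟩

end Degree

/-! ### The Bousfield and Verdier localizations -/

section Localization

variable {K : Type u} [Category.{v} K] [Preadditive K] [HasZeroObject K] [HasShift K ℤ]
  [∀ n : ℤ, (shiftFunctor K n).Additive] [Pretriangulated K] [MonoidalCategory K]
  [SymmetricCategory K] [TTCategory K]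

lemma isZero_tensor_right (X : K) {Y : K} (hY : IsZero Y) : IsZero (X ⊗ Y) :=
  (tensorLeft X).map_isZero hY

lemma isZero_tensor_left {X : K} (hX : IsZero X) (Y : K) : IsZero (X ⊗ Y) :=
  (isZero_tensor_right Y hX).of_iso (β_ X Y)

/-- The action `A ⊗ X ⟶ X` on a module `X`. -/
abbrev act (A X : K) [MonObj A] [ModObj A X] : A ⊗ X ⟶ X := ModObj.smul (M := A) (X := X)

/-- The map `x ↦ 1 ⊗ x`. -/
def unitMap (A : K) [MonObj A] (X : K) : X ⟶ A ⊗ X := (λ_ X).inv ≫ η[A] ▷ X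

instance (A : K) [MonObj A] : NatTrans.CommShift (unitTrans A) ℤ := by
  have : NatTrans.CommShift (leftUnitorNatIso K).inv ℤ := NatTrans.CommShift.of_iso_inv _ _
  exact NatTrans.CommShift.comp _ _ _

lemma unitMap_comp_smul {A : K} [MonObj A] (X : K) [ModObj A X] :
    unitMap A X ≫ act A X = 𝟙 X := by
  rw [unitMap, Category.assoc, ModObj.one_smul_self, Iso.inv_hom_id]

lemma unitMap_naturality (A : K) [MonObj A] {X Y : K} (f : X ⟶ Y) :
    unitMap A X ≫ A ◁ f = f ≫ unitMap A Y :=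
  ((unitTrans A).naturality f).symm

lemma unitMap_naturality_assoc (A : K) [MonObj A] {X Y Z : K} (f : X ⟶ Y) (g : A ⊗ Y ⟶ Z) :
    unitMap A X ≫ A ◁ f ≫ g = f ≫ unitMap A Y ≫ g := by
  rw [← Category.assoc, unitMap_naturality, Category.assoc]

/-- In elements, `a ⊗ x ↦ a ⊗ 1 ⊗ x ↦ a1 ⊗ x`. This is one triangle identity of the free–forgetful
adjunction, and it needs no invertibility of `μ`. -/
lemma whiskerLeft_unitMap_comp_mul (A : K) [MonObj A] (X : K) :
    A ◁ unitMap A X ≫ (α_ A A X).inv ≫ μ[A] ▷ X = 𝟙 _ := by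
  rw [unitMap, MonoidalCategory.whiskerLeft_comp, Category.assoc,
    associator_inv_naturality_middle_assoc, ← comp_whiskerRight, MonObj.mul_one]
  simp

lemma unitMap_tensor (A X Y : K) [MonObj A] :
    unitMap A (X ⊗ Y) = unitMap A X ▷ Y ≫ (α_ A X Y).hom := by
  simp [unitMap]

/-- The adjunction between the free module functor and the forgetful functor. -/
def freeForgetAdjunction (A : K) [MonObj A] : freeFunctor A ⊣ (Mod.forget A : Mod K A ⥤ K) where
  unit := unitTrans A
  counit :=
    { app M := letI := freeModObj A M.X
        Mod.Hom.mk' (M := (freeFunctor A).obj M.X) (N := M)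
          (act A M.X) (by
            change ((α_ A A M.X).inv ≫ μ[A] ▷ M.X) ≫ _ = A ◁ _ ≫ _
            rw [ModObj.mul_smul_self_flip, Category.assoc])
      naturality M N f := by
        ext
        exact (IsModHom.smul_hom (A := A) (f := f.hom)).symm }
  left_triangle_components X := by
    ext
    exact whiskerLeft_unitMap_comp_mul A X
  right_triangle_components M := unitMap_comp_smul M.X

lemma isIso_of_comp_eq_id {X Y : K} (f : X ⟶ Y) (g : Y ⟶ X) [IsIso g] (h : f ≫ g = 𝟙 X) :
    IsIso f := by
  have : f = inv g := by rw [← cancel_mono g, h, IsIso.inv_hom_id]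
  rw [this]
  infer_instance

section

variable (A : K) [MonObj A] [IsIso μ[A]]

/-- This is the equality of the two inclusions of `A`, tensored with `X`: `a ⊗ 1 ⊗ x = 1 ⊗ a ⊗ x`.
-/
lemma whiskerLeft_unitMap (X : K) :
    A ◁ unitMap A X = unitMap A (A ⊗ X) := by
  have h := congrArg (fun f => f ▷ X ≫ (α_ A A X).hom) (inclusions_eq_of_isIso_mul A)
  simpa [unitMap] using h

instance isIso_whiskerLeft_unitMap (X : K) : IsIso (A ◁ unitMap A X) :=
  isIso_of_comp_eq_id _ _ (whiskerLeft_unitMap_comp_mul A X)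

instance isIso_smul (X : K) [ModObj A X] :
    IsIso (act A X) := by
  refine ⟨unitMap A X, ?_, unitMap_comp_smul X⟩
  -- Naturality of the unit at the action turns the composite into `A ◁ (unitMap ≫ act)`, the
  -- identity by unitality.
  rw [← unitMap_naturality, ← whiskerLeft_unitMap, ← MonoidalCategory.whiskerLeft_comp,
    unitMap_comp_smul, MonoidalCategory.whiskerLeft_id]

instance isIso_unitMap (X : K) [ModObj A X] : IsIso (unitMap A X) :=
  isIso_of_comp_eq_id _ _ (unitMap_comp_smul (A := A) X)

lemma isBousfieldLocalization : IsBousfieldLocalization (tensorLeft A) (unitTrans A) where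
  exact := inferInstance
  commShift := inferInstance
  map_eq X := whiskerLeft_unitMap A X
  isIso X := isIso_whiskerLeft_unitMap A X

/-- The action is inverse to `unitMap`, which is natural in all morphisms of `K`, so the action is
natural too. -/
lemma smul_comp_eq {X Y : K} [ModObj A X] [ModObj A Y] (f : X ⟶ Y) :
    act A X ≫ f =
      A ◁ f ≫ act A Y := by
  rw [← cancel_epi (unitMap A X), unitMap_naturality_assoc, unitMap_comp_smul, ← Category.assoc,
    unitMap_comp_smul, Category.id_comp, Category.comp_id]

/-- Every morphism between modules is linear. -/
def forgetFullyFaithful : (Mod.forget A : Mod K A ⥤ K).FullyFaithful where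
  preimage {M N} f := Mod.Hom.mk' (M := M) (N := N) f (smul_comp_eq A (X := M.X) (Y := N.X) f)

instance : (Mod.forget A : Mod K A ⥤ K).Full := (forgetFullyFaithful A).full

instance : (Mod.forget A : Mod K A ⥤ K).Faithful := (forgetFullyFaithful A).faithful

lemma isZero_mod_of_isZero {M : Mod K A} (h : IsZero M.X) : IsZero M where
  unique_to N := ⟨⟨⟨(forgetFullyFaithful A).preimage 0⟩, fun f => by
    ext; exact h.eq_of_src _ _⟩⟩
  unique_from N := ⟨⟨⟨(forgetFullyFaithful A).preimage 0⟩, fun f => by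
    ext; exact h.eq_of_tgt _ _⟩⟩

-- A zero module is isomorphic to the free module on `0`, whose underlying object vanishes.
open ZeroObject in
lemma isZero_mod_iff (M : Mod K A) : IsZero M ↔ IsZero M.X := by
  refine ⟨fun h => ?_, isZero_mod_of_isZero A⟩
  have h₀ : IsZero ((freeFunctor A).obj (0 : K)).X := isZero_tensor_right A (isZero_zero K)
  exact h₀.of_iso ((Mod.forget A).mapIso (h.iso (isZero_mod_of_isZero A h₀)))

lemma isIso_freeFunctor_map_iff {X Y : K} (f : X ⟶ Y) :
    IsIso ((freeFunctor A).map f) ↔ IsIso (A ◁ f) :=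
  ⟨fun _ => inferInstanceAs (IsIso ((Mod.forget A).map ((freeFunctor A).map f))),
    fun h => @isIso_of_fully_faithful _ _ _ _ (Mod.forget A : Mod K A ⥤ K) _ _ _ _
      ((freeFunctor A).map f) h⟩

/-- If `Z` is a cone of `f`, then `A ⊗ Z` is a cone of `A ⊗ f`, so it vanishes exactly when `A ⊗ f`
is invertible. -/
lemma trW_ker_eq : ObjectProperty.trW (fun X : K => IsZero ((freeFunctor A).obj X)) =
    (MorphismProperty.isomorphisms (Mod K A)).inverseImage (freeFunctor A) := by
  ext X Y f
  change _ ↔ IsIso ((freeFunctor A).map f)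
  rw [isIso_freeFunctor_map_iff]
  have key : ∀ (Z : K) (g : Y ⟶ Z) (h : Z ⟶ X⟦(1 : ℤ)⟧), Triangle.mk f g h ∈ distTriang K →
      (IsZero ((freeFunctor A).obj Z) ↔ IsIso (A ◁ f)) := fun Z g h hT =>
    (isZero_mod_iff A _).trans
      (Triangle.isZero₃_iff_isIso₁ _ ((tensorLeft A).map_distinguished _ hT))
  constructor
  · rintro ⟨Z, g, h, hT, hZ⟩
    exact (key Z g h hT).1 hZ
  · intro hf
    obtain ⟨Z, g, h, hT⟩ := distinguished_cocone_triangle f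
    exact ⟨Z, g, h, hT, (key Z g h hT).2 hf⟩

/-- Forgetting after `F_A` gives the exact functor `A ⊗ -`; only the two forms of the boundary map
need to be matched. -/
lemma freeFunctor_mapTriangle_mem {T : Triangle K} (hT : T ∈ distTriang K) :
    (freeFunctor A).mapTriangle.obj T ∈ (modData A).dist := by
  refine isomorphic_distinguished _ ((tensorLeft A).map_distinguished _ hT) _ ?_
  refine Triangle.isoMk _ _ (Iso.refl (A ⊗ T.obj₁)) (Iso.refl (A ⊗ T.obj₂))
    (Iso.refl (A ⊗ T.obj₃)) ?_ ?_ ?_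
  · exact (Category.comp_id _).trans (Category.id_comp _).symm
  · exact (Category.comp_id _).trans (Category.id_comp _).symm
  · change ((A ◁ T.mor₃ ≫ (tensorShift A T.obj₁ 1).hom) ≫ 𝟙 _) ≫ (𝟙 (A ⊗ T.obj₁))⟦(1 : ℤ)⟧' =
      𝟙 (A ⊗ T.obj₃) ≫ A ◁ T.mor₃ ≫ (tensorShift A T.obj₁ 1).hom
    simp only [CategoryTheory.Functor.map_id, Category.comp_id, Category.id_comp]

/-- A triangle of modules is the free module triangle on its underlying triangle. -/
noncomputable def freeForgetTriangleIso (T : Triangle (Mod K A)) :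
    (freeFunctor A).mapTriangle.obj ((Mod.forget A).mapTriangle.obj T) ≅ T := by
  refine Triangle.isoMk _ _ ((asIso (freeForgetAdjunction A).counit).app T.obj₁)
    ((asIso (freeForgetAdjunction A).counit).app T.obj₂)
    ((asIso (freeForgetAdjunction A).counit).app T.obj₃) ?_ ?_ ?_
  · exact (freeForgetAdjunction A).counit.naturality T.mor₁
  · exact (freeForgetAdjunction A).counit.naturality T.mor₂
  · ext
    change (A ◁ (T.mor₃.hom ≫ 𝟙 _) ≫ (tensorShift A T.obj₁.X 1).hom) ≫
      (act A T.obj₁.X)⟦(1 : ℤ)⟧' = act A T.obj₃.X ≫ T.mor₃.hom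
    rw [Category.comp_id]
    exact (Category.assoc _ _ _).trans (IsModHom.smul_hom (A := A) (f := T.mor₃.hom)).symm

lemma isVerdierLocalization :
    IsVerdierLocalization (freeFunctor A) (modData A).dist where
  isLocalization := by
    rw [trW_ker_eq]
    -- A left adjoint of a fully faithful functor is a localization at the morphisms it inverts.
    exact (freeForgetAdjunction A).isLocalization
  dist_eq := by
    ext T
    constructor
    · intro hT
      exact ⟨_, (freeForgetTriangleIso A T).symm, hT⟩
    · rintro ⟨T', e, hT'⟩
      exact isomorphic_distinguished _ (freeFunctor_mapTriangle_mem A hT') _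
        ((Mod.forget A).mapTriangle.mapIso e)

end

end Localization

/-! ### Spectra and the support of `A` -/

section Spectrum

variable {K : Type u} [Category.{v} K] [Preadditive K] [HasZeroObject K] [HasShift K ℤ]
  [∀ n : ℤ, (shiftFunctor K n).Additive] [Pretriangulated K] [MonoidalCategory K]
  [SymmetricCategory K] [TTCategory K]

/-- By the unit law `A ◁ η` is a section of `μ` up to a unitor, hence invertible, and `A ⊗ C` is its
cone. -/
lemma isZero_tensor_cone (A : K) [MonObj A] [IsIso μ[A]] {C : K} {g : A ⟶ C}
    {h : C ⟶ (𝟙_ K)⟦(1 : ℤ)⟧} (hT : Triangle.mk η[A] g h ∈ distTriang K) : IsZero (A ⊗ C) := by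
  refine (Triangle.isZero₃_iff_isIso₁ _ ((tensorLeft A).map_distinguished _ hT)).2 ?_
  change IsIso (A ◁ η[A])
  have : A ◁ η[A] ≫ μ[A] = (ρ_ A).hom := MonObj.mul_one A
  exact IsIso.of_isIso_fac_right this

lemma isClosedUnderIso {D : Type*} [Category* D] [HasShift D ℤ] {E : TTData D}
    {P : ObjectProperty D} (hP : E.IsPrime P) : P.IsClosedUnderIsomorphisms :=
  have := hP.retract
  inferInstance

lemma TTData.IsPrime.mem_of_iso {D : Type*} [Category* D] [HasShift D ℤ] {E : TTData D}
    {P : ObjectProperty D} (hP : E.IsPrime P) {X Y : D} (e : X ≅ Y) (hX : P X) : P Y :=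
  have := isClosedUnderIso hP
  P.prop_of_iso e hX

lemma TTData.IsPrime.mem_of_isZero {D : Type*} [Category* D] [HasShift D ℤ] {E : TTData D}
    {P : ObjectProperty D} (hP : E.IsPrime P) {X : D} (hX : IsZero X) : P X := by
  have := isClosedUnderIso hP
  obtain ⟨Z, hZ, h⟩ := hP.zero
  exact P.prop_of_iso (hZ.iso hX) h

lemma TTData.IsPrime.not_unit {P : ObjectProperty K} (hP : (selfData K).IsPrime P) : ¬ P (𝟙_ K) := by
  intro h
  obtain ⟨X, hX⟩ := hP.proper
  exact hX (hP.ideal X (𝟙_ K) X ⟨(ρ_ X).symm⟩ h)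

lemma TTData.IsPrime.tensor_iff {P : ObjectProperty K} (hP : (selfData K).IsPrime P) (X Y : K) :
    P (X ⊗ Y) ↔ P X ∨ P Y := by
  refine ⟨hP.prime X Y _ ⟨Iso.refl _⟩, ?_⟩
  rintro (h | h)
  · exact hP.ideal Y X _ ⟨β_ X Y⟩ h
  · exact hP.ideal X Y _ ⟨Iso.refl _⟩ h

/-- With `C` the cone of `η`, a prime contains `A` or `C` because `A ⊗ C = 0`. It cannot contain
both, since it would then contain `𝟙`. So the support of `A` is the complement of that of `C`. -/
lemma isClopen_supp (A : K) [MonObj A] [IsIso μ[A]] : IsClopen ((selfData K).supp A) := by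
  have hopen : ∀ X : K, IsOpen ((selfData K).supp X)ᶜ := fun X =>
    TopologicalSpace.isOpen_generateFrom_of_mem ⟨X, rfl⟩
  refine ⟨⟨hopen A⟩, ?_⟩
  obtain ⟨C, g, h, hT⟩ := distinguished_cocone_triangle η[A]
  have : (selfData K).supp A = ((selfData K).supp C)ᶜ := by
    ext ⟨P, hP⟩
    change ¬ P A ↔ ¬ ¬ P C
    rw [not_not]
    constructor
    · intro hA
      exact ((hP.tensor_iff A C).1 (hP.mem_of_isZero (isZero_tensor_cone A hT))).resolve_left hA
    · intro hC hA
      exact hP.not_unit (hP.ext₁ _ hT hA hC)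
  rw [this]
  exact hopen C

variable (A : K) [MonObj A]

variable [IsIso μ[A]]

/-- Both sides are retractions of `m ⊗ n ↦ m ⊗ 1 ⊗ n`, which is invertible. These are the parallel
arrows whose coequalizer is the tensor product over `A`. -/
lemma rightAction_whiskerRight (M N : Mod K A) :
    rightAction A M ▷ N.X = (α_ M.X A N.X).hom ≫ M.X ◁ act A N.X := by
  have h₁ : ((ρ_ M.X).inv ≫ M.X ◁ η[A]) ≫ rightAction A M = 𝟙 _ := by
    rw [rightAction, Category.assoc, BraidedCategory.braiding_naturality_right_assoc,
      ModObj.one_smul_self]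
    simp
  have h₂ : IsIso (rightAction A M) := by
    rw [rightAction]
    infer_instance
  have h₃ : IsIso ((ρ_ M.X).inv ≫ M.X ◁ η[A]) := isIso_of_comp_eq_id _ _ h₁
  rw [← cancel_epi (((ρ_ M.X).inv ≫ M.X ◁ η[A]) ▷ N.X), ← comp_whiskerRight, h₁,
    comp_whiskerRight, Category.assoc, associator_naturality_middle_assoc,
    ← MonoidalCategory.whiskerLeft_comp, ModObj.one_smul_self]
  simp

lemma isTensorOver_iff (M N T : Mod K A) :
    IsTensorOver A M N T ↔ Nonempty (T.X ≅ M.X ⊗ N.X) := by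
  constructor
  · rintro ⟨q, w, ⟨hq⟩, -⟩
    have : IsIso q := isIso_colimit_cocone_parallelPair_of_eq (rightAction_whiskerRight A M N) hq
    exact ⟨(asIso q).symm⟩
  · rintro ⟨e⟩
    refine ⟨e.inv, by rw [rightAction_whiskerRight], ⟨Cofork.IsColimit.mk _
      (fun s => e.hom ≫ s.π) (fun s => e.inv_hom_id_assoc _) (fun s m hm => ?_)⟩, ?_⟩
    · rw [← hm]
      exact (e.hom_inv_id_assoc m).symm
    -- Linearity of the quotient map can be tested after composing with this invertible unit map,
    -- where it reduces to unitality.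
    · have h : unitMap A (M.X ⊗ N.X) ≫ (α_ A M.X N.X).inv ≫ act A M.X ▷ N.X = 𝟙 _ := by
        rw [unitMap_tensor, Category.assoc, Iso.hom_inv_id_assoc, ← comp_whiskerRight,
          unitMap_comp_smul, id_whiskerRight]
      have : IsIso (unitMap A (M.X ⊗ N.X)) := isIso_of_comp_eq_id _ _ h
      rw [← cancel_epi (unitMap A (M.X ⊗ N.X)), unitMap_naturality_assoc, unitMap_comp_smul,
        Category.comp_id]
      have := congrArg (· ≫ e.inv) h
      simpa using this.symm

/-- The counit isomorphism `A ⊗ M ≅ M` of a module `M`. -/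
noncomputable def freeForgetIso (M : Mod K A) : (freeFunctor A).obj M.X ≅ M :=
  (asIso (freeForgetAdjunction A).counit).app M

lemma isTensorOver_free (X Y Z : K) (e : Z ≅ X ⊗ Y) : IsTensorOver A ((freeFunctor A).obj X)
    ((freeFunctor A).obj Y) ((freeFunctor A).obj Z) := by
  rw [isTensorOver_iff]
  -- The chain is `A ⊗ Z ≅ A ⊗ (X ⊗ Y) ≅ (A ⊗ A) ⊗ (X ⊗ Y) ≅ (A ⊗ X) ⊗ (A ⊗ Y)`.
  exact ⟨whiskerLeftIso A e ≪≫ (whiskerRightIso (asIso μ[A]) (X ⊗ Y)).symm ≪≫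
    ⟨tensorμ A A X Y, tensorδ A A X Y, tensorμ_tensorδ A A X Y, tensorδ_tensorμ A A X Y⟩⟩

lemma isPrime_inverseImage_free {Q : ObjectProperty (Mod K A)} (hQ : (modData A).IsPrime Q) :
    (selfData K).IsPrime (Q.inverseImage (freeFunctor A)) where
  zero := ⟨_, isZero_zero K, hQ.mem_of_isZero
    ((isZero_mod_iff A _).2 (isZero_tensor_right A (isZero_zero K)))⟩
  shift := ⟨fun n => ⟨fun X hX => hQ.mem_of_iso (((freeFunctor A).commShiftIso n).symm.app X)
    (hQ.shift.isStableUnderShiftBy n |>.le_shift _ hX)⟩⟩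
  ext₁ T hT := hQ.ext₁ _ (freeFunctor_mapTriangle_mem A hT)
  ext₂ T hT := hQ.ext₂ _ (freeFunctor_mapTriangle_mem A hT)
  ext₃ T hT := hQ.ext₃ _ (freeFunctor_mapTriangle_mem A hT)
  retract := ⟨fun r h => hQ.retract.of_retract (r.map (freeFunctor A)) h⟩
  ideal X Y Z := fun ⟨e⟩ => hQ.ideal _ _ _ (isTensorOver_free A X Y Z e)
  proper := by
    obtain ⟨M, hM⟩ := hQ.proper
    exact ⟨M.X, fun h => hM (hQ.mem_of_iso (freeForgetIso A M) h)⟩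
  prime X Y Z := fun ⟨e⟩ => hQ.prime _ _ _ (isTensorOver_free A X Y Z e)

/-- The free module on `A` is `A ⊗ A ≅ A`, a unit for the tensor product of modules, so an ideal
containing it is everything. -/
lemma not_free_self_mem {Q : ObjectProperty (Mod K A)} (hQ : (modData A).IsPrime Q) :
    ¬ Q ((freeFunctor A).obj A) := by
  intro h
  obtain ⟨M, hM⟩ := hQ.proper
  refine hM (hQ.ideal M _ M ((isTensorOver_iff A _ _ _).2 ⟨?_⟩) h)
  exact (asIso (act A M.X)).symm ≪≫ β_ A M.X ≪≫ whiskerLeftIso M.X (asIso μ[A]).symm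

open ZeroObject in
lemma isPrime_inverseImage_forget {P : ObjectProperty K} (hP : (selfData K).IsPrime P)
    (hA : ¬ P A) : (modData A).IsPrime (P.inverseImage (Mod.forget A)) where
  zero := ⟨(freeFunctor A).obj 0,
    (isZero_mod_iff A _).2 (isZero_tensor_right A (isZero_zero K)),
    hP.mem_of_isZero (isZero_tensor_right A (isZero_zero K))⟩
  shift := ⟨fun n => ⟨fun _ hX => hP.shift.isStableUnderShiftBy n |>.le_shift _ hX⟩⟩
  ext₁ _ hT := hP.ext₁ _ hT
  ext₂ _ hT := hP.ext₂ _ hT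
  ext₃ _ hT := hP.ext₃ _ hT
  retract := ⟨fun r h => hP.retract.of_retract (r.map (Mod.forget A)) h⟩
  ideal M N T h := hP.ideal M.X N.X T.X ((isTensorOver_iff A _ _ _).1 h)
  proper := ⟨Mod.regular A, hA⟩
  prime M N T h := hP.prime M.X N.X T.X ((isTensorOver_iff A _ _ _).1 h)

/-- The homeomorphism `Q ↦ F_A⁻¹(Q)` from the spectrum of `A-Mod` onto the support of `A`. -/
noncomputable def spcHomeomorph : (modData A).Spc ≃ₜ (selfData K).supp A where
  toFun Q := ⟨⟨_, isPrime_inverseImage_free A Q.2⟩, not_free_self_mem A Q.2⟩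
  invFun P := ⟨_, isPrime_inverseImage_forget A P.1.2 P.2⟩
  left_inv Q := Subtype.ext <| by
    ext M
    exact ⟨Q.2.mem_of_iso (freeForgetIso A M), Q.2.mem_of_iso (freeForgetIso A M).symm⟩
  right_inv P := Subtype.ext <| Subtype.ext <| by
    ext X
    -- The round trip sends `P` to the objects `X` with `A ⊗ X ∈ P`; as `A ∉ P`, primality returns
    -- `P`.
    exact (P.1.2.tensor_iff A X).trans (or_iff_right P.2)
  continuous_toFun := Continuous.subtype_mk (continuous_generateFrom_iff.2 (by
    rintro _ ⟨X, rfl⟩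
    exact TopologicalSpace.isOpen_generateFrom_of_mem ⟨(freeFunctor A).obj X, rfl⟩)) _
  continuous_invFun := continuous_generateFrom_iff.2 (by
    rintro _ ⟨M, rfl⟩
    have h : IsOpen ((selfData K).supp M.X)ᶜ :=
      TopologicalSpace.isOpen_generateFrom_of_mem ⟨M.X, rfl⟩
    exact h.preimage continuous_subtype_val)

end Spectrum

/-! ### Quotients of tt-categories by central idempotents -/

/-- An idempotent endomorphism of the identity functor that is compatible with the shifts and the
tensor products. -/
structure CentralIdempotent (K : Type u) [Category.{v} K] [Preadditive K] [HasShift K ℤ]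
    [MonoidalCategory K] where
  /-- the components -/
  app (X : K) : X ⟶ X
  naturality {X Y : K} (f : X ⟶ Y) : f ≫ app Y = app X ≫ f
  idem (X : K) : app X ≫ app X = app X
  shift (X : K) (n : ℤ) : (app X)⟦n⟧' = app (X⟦n⟧)
  whiskerLeft (X Y : K) : X ◁ app Y = app (X ⊗ Y)
  whiskerRight (X Y : K) : app X ▷ Y = app (X ⊗ Y)

namespace CentralIdempotent

section Preadditive

variable {K : Type u} [Category.{v} K] [Preadditive K] [HasShift K ℤ] [MonoidalCategory K]
  (e : CentralIdempotent K)

/-- Two morphisms are identified if they agree on the part cut out by `e`. -/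
def rel : HomRel K := fun _ Y f g => f ≫ e.app Y = g ≫ e.app Y

lemma rel_iff {X Y : K} (f g : X ⟶ Y) : e.rel f g ↔ f ≫ e.app Y = g ≫ e.app Y := Iff.rfl

instance : Congruence e.rel where
  equivalence := ⟨fun _ => rfl, fun h => Eq.symm h, fun h h' => Eq.trans h h'⟩
  comp_left f _ _ h := by
    rw [rel_iff, Category.assoc, Category.assoc, (e.rel_iff _ _).1 h]
  comp_right g h := by
    rw [rel_iff, Category.assoc, Category.assoc, e.naturality g, reassoc_of% (e.rel_iff _ _).1 h]

instance : e.rel.IsCompatibleWithShift ℤ where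
  condition n X Y f g h := by
    rw [rel_iff, ← e.shift, ← Functor.map_comp, (e.rel_iff _ _).1 h, Functor.map_comp]

/-- The part of `K` on which `e` is the identity. -/
abbrev Part := CategoryTheory.Quotient e.rel

/-- The projection onto the part cut out by `e`. -/
abbrev proj : K ⥤ e.Part := CategoryTheory.Quotient.functor e.rel

lemma map_proj_eq_iff {X Y : K} (f g : X ⟶ Y) :
    e.proj.map f = e.proj.map g ↔ f ≫ e.app Y = g ≫ e.app Y :=
  CategoryTheory.Quotient.functor_map_eq_iff _ _ _

lemma map_app (X : K) : e.proj.map (e.app X) = 𝟙 _ := by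
  rw [← CategoryTheory.Functor.map_id, map_proj_eq_iff, e.idem, Category.id_comp]

lemma proj_map_surjective {X Y : e.Part} (f : X ⟶ Y) :
    ∃ f₀ : X.as ⟶ Y.as, e.proj.map f₀ = f := by
  obtain ⟨f₀⟩ := f
  exact ⟨f₀, rfl⟩

lemma rel_add ⦃X Y : K⦄ (f₁ f₂ g₁ g₂ : X ⟶ Y) (hf : e.rel f₁ f₂) (hg : e.rel g₁ g₂) :
    e.rel (f₁ + g₁) (f₂ + g₂) := by
  rw [rel_iff] at *
  rw [Preadditive.add_comp, Preadditive.add_comp, hf, hg]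

instance : Preadditive e.Part := CategoryTheory.Quotient.preadditive _ e.rel_add

instance : e.proj.Additive := CategoryTheory.Quotient.functor_additive _ e.rel_add

open ZeroObject in
instance [HasZeroObject K] : HasZeroObject e.Part :=
  ⟨e.proj.obj 0, e.proj.map_isZero (isZero_zero K)⟩

instance [∀ n : ℤ, (shiftFunctor K n).Additive] (n : ℤ) : (shiftFunctor e.Part n).Additive := by
  have : (e.proj ⋙ shiftFunctor e.Part n).Additive :=
    Functor.additive_of_iso (e.proj.commShiftIso n)
  exact Functor.additive_of_full_essSurj_comp e.proj _

instance [IsIdempotentComplete K] : IsIdempotentComplete e.Part where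
  idempotents_split := by
    rintro ⟨X⟩ p hp
    obtain ⟨p₀, rfl⟩ := e.proj_map_surjective p
    have h : p₀ ≫ p₀ ≫ e.app X = p₀ ≫ e.app X := by
      rw [← Functor.map_comp, map_proj_eq_iff, Category.assoc] at hp
      exact hp
    -- The lift `p₀` need not be idempotent, but `p₀ ≫ e` is, and both have the same image in the
    -- quotient.
    obtain ⟨Y, i, q, hi, hq⟩ := IsIdempotentComplete.idempotents_split X (p₀ ≫ e.app X) (by
      rw [Category.assoc, ← reassoc_of% (e.naturality p₀), e.idem, h])
    refine ⟨e.proj.obj Y, e.proj.map i, e.proj.map q, ?_, ?_⟩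
    · rw [← Functor.map_comp, hi, CategoryTheory.Functor.map_id]
    · rw [← Functor.map_comp, hq, Functor.map_comp, map_app, Category.comp_id]

end Preadditive

section Triangulated

variable {K : Type u} [Category.{v} K] [Preadditive K] [HasZeroObject K] [HasShift K ℤ]
  [∀ n : ℤ, (shiftFunctor K n).Additive] [Pretriangulated K] [MonoidalCategory K]
  (e : CentralIdempotent K)

/-- Lifts of `a` and `b` form a commuting square only after composition with `e`. The corrected
lifts extend to a morphism of triangles in `K`, and the correction disappears in the quotient
because `e` becomes the identity. -/
lemma proj_complete_triangle_morphism (T₁ T₂ : Triangle K) (h₁ : T₁ ∈ distTriang K)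
    (h₂ : T₂ ∈ distTriang K) (a : e.proj.obj T₁.obj₁ ⟶ e.proj.obj T₂.obj₁)
    (b : e.proj.obj T₁.obj₂ ⟶ e.proj.obj T₂.obj₂)
    (w : e.proj.map T₁.mor₁ ≫ b = a ≫ e.proj.map T₂.mor₁) :
    ∃ φ : e.proj.mapTriangle.obj T₁ ⟶ e.proj.mapTriangle.obj T₂, φ.hom₁ = a ∧ φ.hom₂ = b := by
  obtain ⟨a, rfl⟩ := e.proj.map_surjective a
  obtain ⟨b, rfl⟩ := e.proj.map_surjective b
  rw [← Functor.map_comp, ← Functor.map_comp, map_proj_eq_iff, Category.assoc, Category.assoc,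
    e.naturality T₂.mor₁] at w
  let φ := completeDistinguishedTriangleMorphism T₁ T₂ h₁ h₂ (a ≫ e.app _) (b ≫ e.app _) (by
    rw [w, Category.assoc])
  refine ⟨e.proj.mapTriangle.map φ, ?_, ?_⟩
  · change e.proj.map (a ≫ e.app _) = _
    rw [Functor.map_comp, map_app, Category.comp_id]
  · change e.proj.map (b ≫ e.app _) = _
    rw [Functor.map_comp, map_app, Category.comp_id]

instance : Pretriangulated e.Part where
  distinguishedTriangles := e.proj.essImageDistTriang
  isomorphic_distinguished _ hT _ i := e.proj.essImageDistTriang_mem_of_iso i hT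
  contractible_distinguished := e.proj.contractible_mem_essImageDistTriang
  distinguished_cocone_triangle f := by
    obtain ⟨f₀, rfl⟩ := e.proj_map_surjective f
    obtain ⟨Z, g, h, hT⟩ := Pretriangulated.distinguished_cocone_triangle f₀
    exact ⟨e.proj.obj Z, e.proj.map g, e.proj.map h ≫ (e.proj.commShiftIso (1 : ℤ)).hom.app _, _,
      Iso.refl _, hT⟩
  rotate_distinguished_triangle := e.proj.rotate_essImageDistTriang
  complete_distinguished_triangle_morphism T₁ T₂ h₁ h₂ a b w :=
    e.proj.complete_distinguished_essImageDistTriang_morphism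
      e.proj_complete_triangle_morphism T₁ T₂ h₁ h₂ a b w

instance : e.proj.IsTriangulated where
  map_distinguished T hT := ⟨T, Iso.refl _, hT⟩

instance : e.proj.mapArrow.EssSurj where
  mem_essImage f := by
    obtain ⟨f₀, hf⟩ := e.proj_map_surjective f.hom
    exact ⟨Arrow.mk f₀, ⟨Arrow.isoMk (Iso.refl _) (Iso.refl _) (by
      change 𝟙 _ ≫ f.hom = e.proj.map f₀ ≫ 𝟙 _
      rw [hf, Category.comp_id, Category.id_comp])⟩⟩

/-- Composable pairs lift to `K`, so the octahedral axiom descends to the quotient. -/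
instance : (e.proj.mapComposableArrows 2).EssSurj where
  mem_essImage F := by
    obtain ⟨X₀, X₁, X₂, f, g, rfl⟩ := ComposableArrows.mk₂_surjective F
    obtain ⟨f, rfl⟩ := e.proj_map_surjective f
    obtain ⟨g, rfl⟩ := e.proj_map_surjective g
    exact ⟨ComposableArrows.mk₂ f g, ⟨ComposableArrows.isoMk₂ (Iso.refl _) (Iso.refl _)
      (Iso.refl _) ((Category.comp_id _).trans (Category.id_comp _).symm)
      ((Category.comp_id _).trans (Category.id_comp _).symm)⟩⟩

instance [IsTriangulated K] : IsTriangulated e.Part :=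
  isTriangulated_of_essSurj_mapComposableArrows_two e.proj

end Triangulated

/-! ### The tensor product on the quotient -/

section Monoidal

variable {K : Type u} [Category.{v} K] [Preadditive K] [HasShift K ℤ] [MonoidalCategory K]
  (e : CentralIdempotent K)

lemma rel_whiskerLeft (X : K) {Y Z : K} {f g : Y ⟶ Z} (h : e.rel f g) :
    e.rel (X ◁ f) (X ◁ g) := by
  rw [rel_iff] at *
  rw [← e.whiskerLeft, ← MonoidalCategory.whiskerLeft_comp, h, MonoidalCategory.whiskerLeft_comp]

lemma rel_whiskerRight {Y Z : K} {f g : Y ⟶ Z} (h : e.rel f g) (X : K) :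
    e.rel (f ▷ X) (g ▷ X) := by
  rw [rel_iff] at *
  rw [← e.whiskerRight, ← comp_whiskerRight, h, comp_whiskerRight]

/-- The functor induced by `X ⊗ -`. -/
abbrev partTensorLeft (X : K) : e.Part ⥤ e.Part :=
  CategoryTheory.Quotient.lift e.rel (tensorLeft X ⋙ e.proj)
    (fun _ _ _ _ h => CategoryTheory.Quotient.sound _ (e.rel_whiskerLeft X h))

/-- The functor induced by `- ⊗ X`. -/
abbrev partTensorRight (X : K) : e.Part ⥤ e.Part :=
  CategoryTheory.Quotient.lift e.rel (tensorRight X ⋙ e.proj)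
    (fun _ _ _ _ h => CategoryTheory.Quotient.sound _ (e.rel_whiskerRight h X))

instance : MonoidalCategoryStruct e.Part where
  tensorObj X Y := e.proj.obj (X.as ⊗ Y.as)
  tensorUnit := e.proj.obj (𝟙_ K)
  whiskerLeft X _ _ f := (e.partTensorLeft X.as).map f
  whiskerRight f X := (e.partTensorRight X.as).map f
  associator X Y Z := e.proj.mapIso (α_ X.as Y.as Z.as)
  leftUnitor X := e.proj.mapIso (λ_ X.as)
  rightUnitor X := e.proj.mapIso (ρ_ X.as)

instance : MonoidalCategory e.Part where
  tensorHom_def _ _ := rfl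
  id_tensorHom_id X Y := congrArg e.proj.map (by
    simp : 𝟙 X.as ▷ Y.as ≫ X.as ◁ 𝟙 Y.as = 𝟙 (X.as ⊗ Y.as))
  tensorHom_comp_tensorHom := by
    rintro ⟨X₁⟩ ⟨Y₁⟩ ⟨Z₁⟩ ⟨X₂⟩ ⟨Y₂⟩ ⟨Z₂⟩ ⟨f₁⟩ ⟨f₂⟩ ⟨g₁⟩ ⟨g₂⟩
    refine congrArg e.proj.map (?_ : (f₁ ▷ X₂ ≫ Y₁ ◁ f₂) ≫ g₁ ▷ Y₂ ≫ Z₁ ◁ g₂ =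
      (f₁ ≫ g₁) ▷ X₂ ≫ Z₁ ◁ (f₂ ≫ g₂))
    simp [whisker_exchange_assoc]
  whiskerLeft_id X Y := congrArg e.proj.map (MonoidalCategory.whiskerLeft_id X.as Y.as)
  id_whiskerRight X Y := congrArg e.proj.map (MonoidalCategory.id_whiskerRight X.as Y.as)
  associator_naturality := by
    rintro ⟨X₁⟩ ⟨X₂⟩ ⟨X₃⟩ ⟨Y₁⟩ ⟨Y₂⟩ ⟨Y₃⟩ ⟨f₁⟩ ⟨f₂⟩ ⟨f₃⟩
    refine congrArg e.proj.map (?_ : ((f₁ ▷ X₂ ≫ Y₁ ◁ f₂) ▷ X₃ ≫ (Y₁ ⊗ Y₂) ◁ f₃) ≫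
      (α_ Y₁ Y₂ Y₃).hom = (α_ X₁ X₂ X₃).hom ≫ f₁ ▷ (X₂ ⊗ X₃) ≫ Y₁ ◁ (f₂ ▷ X₃ ≫ Y₂ ◁ f₃))
    simp
  leftUnitor_naturality := by
    rintro ⟨X⟩ ⟨Y⟩ ⟨f⟩
    exact congrArg e.proj.map (leftUnitor_naturality f)
  rightUnitor_naturality := by
    rintro ⟨X⟩ ⟨Y⟩ ⟨f⟩
    exact congrArg e.proj.map (rightUnitor_naturality f)
  pentagon W X Y Z := congrArg e.proj.map (pentagon W.as X.as Y.as Z.as)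
  triangle X Y := congrArg e.proj.map (triangle X.as Y.as)

instance [BraidedCategory K] : BraidedCategory e.Part where
  braiding X Y := e.proj.mapIso (β_ X.as Y.as)
  braiding_naturality_right := by
    rintro ⟨X⟩ ⟨Y⟩ ⟨Z⟩ ⟨f⟩
    exact congrArg e.proj.map (BraidedCategory.braiding_naturality_right X f)
  braiding_naturality_left := by
    rintro ⟨X⟩ ⟨Y⟩ ⟨f⟩ ⟨Z⟩
    exact congrArg e.proj.map (BraidedCategory.braiding_naturality_left f Z)
  hexagon_forward X Y Z :=
    congrArg e.proj.map (BraidedCategory.hexagon_forward X.as Y.as Z.as)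
  hexagon_reverse X Y Z :=
    congrArg e.proj.map (BraidedCategory.hexagon_reverse X.as Y.as Z.as)

instance [SymmetricCategory K] : SymmetricCategory e.Part where
  symmetry X Y := congrArg e.proj.map (SymmetricCategory.symmetry X.as Y.as)

/-- The projection is strictly monoidal. -/
def projCoreMonoidal : e.proj.CoreMonoidal where
  εIso := Iso.refl _
  μIso _ _ := Iso.refl _
  μIso_hom_natural_left _ _ := (Category.comp_id _).trans (Category.id_comp _).symm
  μIso_hom_natural_right _ _ := (Category.comp_id _).trans (Category.id_comp _).symm
  associativity X Y Z := congrArg e.proj.map (by simp :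
    (𝟙 (X ⊗ Y) ▷ Z) ≫ 𝟙 _ ≫ (α_ X Y Z).hom = (α_ X Y Z).hom ≫ (X ◁ 𝟙 (Y ⊗ Z)) ≫ 𝟙 _)
  left_unitality X := congrArg e.proj.map (by simp :
    (λ_ X).hom = (𝟙 (𝟙_ K) ▷ X) ≫ 𝟙 _ ≫ (λ_ X).hom)
  right_unitality X := congrArg e.proj.map (by simp :
    (ρ_ X).hom = (X ◁ 𝟙 (𝟙_ K)) ≫ 𝟙 _ ≫ (ρ_ X).hom)

instance : e.proj.Monoidal := e.projCoreMonoidal.toMonoidal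

lemma proj_μ (X Y : K) : Functor.LaxMonoidal.μ e.proj X Y = 𝟙 (e.proj.obj (X ⊗ Y)) := rfl

instance [BraidedCategory K] : e.proj.Braided where
  braided _ _ := (Category.id_comp _).trans (Category.comp_id _).symm

end Monoidal

section TensorTriangulated

variable {K : Type u} [Category.{v} K] [Preadditive K] [HasZeroObject K] [HasShift K ℤ]
  [∀ n : ℤ, (shiftFunctor K n).Additive] [Pretriangulated K] [MonoidalCategory K]
  [SymmetricCategory K] [TTCategory K] (e : CentralIdempotent K)

noncomputable instance (X : K) : (e.partTensorLeft X).CommShift ℤ :=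
  CategoryTheory.Quotient.liftCommShift _ _ _ _

instance (X : K) : (e.partTensorLeft X).IsTriangulated :=
  Functor.isTriangulated_of_precomp_iso (F := e.proj) (H := tensorLeft X ⋙ e.proj)
    (CategoryTheory.Quotient.lift.isLift _ _ _)

/-- Tensoring with an object commutes with the shifts. -/
noncomputable abbrev tensorLeftCommShift (X : e.Part) : (tensorLeft X).CommShift ℤ :=
  inferInstanceAs ((e.partTensorLeft X.as).CommShift ℤ)

attribute [local instance] tensorLeftCommShift

/-- This makes the induced shift isomorphism explicit, so that each tt-coherence on the quotient
becomes the image of the one in `K`, up to the shift isomorphisms of the projection. -/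
lemma tensorLeft_commShiftIso_hom_app (X Y : K) (n : ℤ) :
    ((tensorLeft (e.proj.obj X)).commShiftIso n).hom.app (e.proj.obj Y) =
      e.proj.obj X ◁ (e.proj.commShiftIso n).inv.app Y ≫ e.proj.map (tensorShift X Y n).hom ≫
        (e.proj.commShiftIso n).hom.app (X ⊗ Y) := by
  refine (CategoryTheory.Quotient.LiftCommShift.iso_hom_app _ _ _ _ _).trans ?_
  rw [Functor.commShiftIso_comp_hom_app]
  rfl

lemma shift_map_proj {X Y : K} (f : X ⟶ Y) (n : ℤ) :
    (e.proj.commShiftIso n).hom.app X ≫ (e.proj.map f)⟦n⟧' =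
      e.proj.map (f⟦n⟧') ≫ (e.proj.commShiftIso n).hom.app Y :=
  (e.proj.commShiftIso_hom_naturality f n).symm

noncomputable instance : TTCategory e.Part where
  isTriangulated := inferInstance
  isIdempotentComplete := inferInstance
  commShift X := e.tensorLeftCommShift X
  exact X := inferInstanceAs (e.partTensorLeft X.as).IsTriangulated
  natural {X X'} f := ⟨fun n => by
    obtain ⟨f, rfl⟩ := e.proj_map_surjective f
    ext ⟨Y⟩
    change ((tensorLeft (e.proj.obj X.as)).commShiftIso n).hom.app (e.proj.obj Y) ≫
        (e.proj.map (f ▷ Y))⟦n⟧' = e.proj.map f ▷ (e.proj.obj Y)⟦n⟧ ≫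
      ((tensorLeft (e.proj.obj X'.as)).commShiftIso n).hom.app (e.proj.obj Y)
    rw [tensorLeft_commShiftIso_hom_app, tensorLeft_commShiftIso_hom_app, Category.assoc,
      Category.assoc, shift_map_proj, ← Functor.map_comp_assoc, ← tensorShift_natural_left,
      ← whisker_exchange_assoc, Functor.map_comp, Category.assoc]
    rfl⟩
  assoc X Y := ⟨fun n => by
    ext ⟨Z⟩
    change ((tensorLeft (e.proj.obj (X.as ⊗ Y.as))).commShiftIso n).hom.app (e.proj.obj Z) ≫
        (e.proj.map (α_ X.as Y.as Z).hom)⟦n⟧' =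
      (α_ (e.proj.obj X.as) (e.proj.obj Y.as) ((e.proj.obj Z)⟦n⟧)).hom ≫
        (((tensorLeft (e.proj.obj Y.as)) ⋙ tensorLeft (e.proj.obj X.as)).commShiftIso n).hom.app
          (e.proj.obj Z)
    rw [Functor.commShiftIso_comp_hom_app]
    change _ = _ ≫ e.proj.obj X.as ◁ _ ≫
      ((tensorLeft (e.proj.obj X.as)).commShiftIso n).hom.app (e.proj.obj (Y.as ⊗ Z))
    rw [tensorLeft_commShiftIso_hom_app, tensorLeft_commShiftIso_hom_app,
      tensorLeft_commShiftIso_hom_app, Category.assoc, Category.assoc, shift_map_proj,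
      ← Functor.map_comp_assoc, tensorShift_assoc, MonoidalCategory.whiskerLeft_comp,
      MonoidalCategory.whiskerLeft_comp, Category.assoc, Category.assoc,
      ← whiskerLeft_comp_assoc (e.proj.obj X.as) ((e.proj.commShiftIso n).hom.app _),
      Iso.hom_inv_id_app, MonoidalCategory.whiskerLeft_id, Category.id_comp,
      Functor.map_comp_assoc, Functor.map_comp_assoc]
    exact associator_naturality_right_assoc _ _ _ _⟩
  unit := ⟨fun n => by
    ext ⟨Y⟩
    change ((tensorLeft (e.proj.obj (𝟙_ K))).commShiftIso n).hom.app (e.proj.obj Y) ≫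
        (e.proj.map (λ_ Y).hom)⟦n⟧' =
      (λ_ ((e.proj.obj Y)⟦n⟧)).hom ≫ ((𝟭 e.Part).commShiftIso n).hom.app (e.proj.obj Y)
    rw [tensorLeft_commShiftIso_hom_app, Category.assoc, Category.assoc, shift_map_proj,
      ← Functor.map_comp_assoc, tensorShift_unit, Functor.commShiftIso_id_hom_app,
      Category.comp_id]
    refine (leftUnitor_naturality_assoc ((e.proj.commShiftIso n).inv.app Y) _).trans ?_
    rw [Iso.inv_hom_id_app]
    exact Category.comp_id _⟩

end TensorTriangulated

end CentralIdempotent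

/-! ### Idempotents of the unit and the product decomposition -/

section TTFunctor

variable {K : Type u} [Category.{v} K] [Preadditive K] [HasZeroObject K] [HasShift K ℤ]
  [∀ n : ℤ, (shiftFunctor K n).Additive] [Pretriangulated K] [MonoidalCategory K]
  [SymmetricCategory K] [TTCategory K]

lemma CentralIdempotent.proj_tensorShift (e : CentralIdempotent K) (X Y : K) (n : ℤ) :
    e.proj.obj X ◁ (e.proj.commShiftIso n).hom.app Y ≫
        (tensorShift (e.proj.obj X) (e.proj.obj Y) n).hom ≫
        (Functor.LaxMonoidal.μ e.proj X Y)⟦n⟧' =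
      Functor.LaxMonoidal.μ e.proj X (Y⟦n⟧) ≫ e.proj.map (tensorShift X Y n).hom ≫
        (e.proj.commShiftIso n).hom.app (X ⊗ Y) := by
  rw [proj_μ, proj_μ]
  refine (congrArg (fun f => e.proj.obj X ◁ (e.proj.commShiftIso n).hom.app Y ≫ f)
    ((congrArg (fun f => _ ≫ f) ((shiftFunctor e.Part n).map_id _)).trans
      ((Category.comp_id _).trans (e.tensorLeft_commShiftIso_hom_app X Y n)))).trans ?_
  rw [← whiskerLeft_comp_assoc, Iso.hom_inv_id_app]
  exact (congrArg (fun f => f ≫ _) (MonoidalCategory.whiskerLeft_id _ _))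

/-- The part cut out by a central idempotent, as a tt-category. -/
noncomputable def CentralIdempotent.ttPart (e : CentralIdempotent K) : TTCat.{v, u} where
  carrier := e.Part

/-- The projection onto the part cut out by a central idempotent, as a tt-functor. -/
noncomputable def CentralIdempotent.ttProj (e : CentralIdempotent K) :
    TTFunctor K e.ttPart.carrier where
  functor := e.proj
  braided := (inferInstance : e.proj.Braided)
  commShift := (inferInstance : e.proj.CommShift ℤ)
  exact := (inferInstance : e.proj.IsTriangulated)
  compat := e.proj_tensorShift

/-- Exactness makes `X ⊗ -` additive; the symmetry transfers this to `- ⊗ X`. -/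
instance : MonoidalPreadditive K where
  whiskerLeft_zero {X _ _} := (tensorLeft X).map_zero _ _
  zero_whiskerRight {X Y Z} := by
    rw [← cancel_mono (β_ Z X).hom, BraidedCategory.braiding_naturality_left, zero_comp]
    exact ((β_ Y X).hom ≫= (tensorLeft X).map_zero Y Z).trans comp_zero
  whiskerLeft_add {X _ _} f g := (tensorLeft X).map_add (f := f) (g := g)
  add_whiskerRight {X Y Z} f g := by
    have h : X ◁ (f + g) = X ◁ f + X ◁ g := (tensorLeft X).map_add (f := f) (g := g)
    rw [← cancel_mono (β_ Z X).hom, Preadditive.add_comp,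
      BraidedCategory.braiding_naturality_left, BraidedCategory.braiding_naturality_left,
      BraidedCategory.braiding_naturality_left, h, Preadditive.comp_add]

/-- The central idempotent complementary to a central idempotent. -/
def CentralIdempotent.compl (e : CentralIdempotent K) : CentralIdempotent K where
  app X := 𝟙 X - e.app X
  naturality f := by
    rw [Preadditive.comp_sub, Preadditive.sub_comp, e.naturality, Category.comp_id,
      Category.id_comp]
  idem X := Idempotents.idem_of_id_sub_idem _ (e.idem X)
  shift X n := by
    rw [Functor.map_sub, CategoryTheory.Functor.map_id, e.shift]
  whiskerLeft X Y := by
    have := (tensorLeft X).map_sub (f := 𝟙 Y) (g := e.app Y)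
    dsimp at this
    rw [this, MonoidalCategory.whiskerLeft_id, e.whiskerLeft]
  whiskerRight X Y := by
    have := (tensorRight Y).map_sub (f := 𝟙 X) (g := e.app X)
    dsimp at this
    rw [this, id_whiskerRight, e.whiskerRight]

/-- The action of an endomorphism of the unit on an object. -/
def unitScalar (a : 𝟙_ K ⟶ 𝟙_ K) (X : K) : X ⟶ X := (λ_ X).inv ≫ a ▷ X ≫ (λ_ X).hom

lemma unitScalar_naturality (a : 𝟙_ K ⟶ 𝟙_ K) {X Y : K} (f : X ⟶ Y) :
    f ≫ unitScalar a Y = unitScalar a X ≫ f := by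
  rw [unitScalar, unitScalar, Category.assoc, Category.assoc, ← leftUnitor_naturality,
    ← whisker_exchange_assoc, leftUnitor_inv_naturality_assoc]

lemma unitScalar_whiskerRight (a : 𝟙_ K ⟶ 𝟙_ K) (X Y : K) :
    unitScalar a X ▷ Y = unitScalar a (X ⊗ Y) := by
  simp [unitScalar]

/-- Conjugating by the braiding reduces this to whiskering on the other side, since the scalar
action is natural. -/
lemma unitScalar_whiskerLeft (a : 𝟙_ K ⟶ 𝟙_ K) (X Y : K) :
    X ◁ unitScalar a Y = unitScalar a (X ⊗ Y) := by
  rw [← cancel_mono (β_ X Y).hom, BraidedCategory.braiding_naturality_right,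
    unitScalar_whiskerRight, unitScalar_naturality]

lemma unitScalar_shift (a : 𝟙_ K ⟶ 𝟙_ K) (X : K) (n : ℤ) :
    (unitScalar a X)⟦n⟧' = unitScalar a (X⟦n⟧) := by
  have h := tensorShift_unit X n
  have h' : (λ_ X).inv⟦n⟧' = (λ_ (X⟦n⟧)).inv ≫ (tensorShift (𝟙_ K) X n).hom := by
    rw [← cancel_mono ((λ_ X).hom⟦n⟧'), Category.assoc, h, ← Functor.map_comp]
    simp
  rw [unitScalar, unitScalar, Functor.map_comp, Functor.map_comp, h', ← h, Category.assoc,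
    reassoc_of% (tensorShift_natural_left a X n)]

/-- An idempotent endomorphism of the unit defines a central idempotent. -/
def centralIdempotentOfUnit (a : 𝟙_ K ⟶ 𝟙_ K) (ha : a ≫ a = a) : CentralIdempotent K where
  app := unitScalar a
  naturality := unitScalar_naturality a
  idem X := by simp [unitScalar, ← comp_whiskerRight_assoc, ha]
  shift := unitScalar_shift a
  whiskerLeft := unitScalar_whiskerLeft a
  whiskerRight := unitScalar_whiskerRight a

lemma centralIdempotentOfUnit_app_unit (a : 𝟙_ K ⟶ 𝟙_ K) (ha : a ≫ a = a) :
    (centralIdempotentOfUnit a ha).app (𝟙_ K) = a := by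
  change (λ_ (𝟙_ K)).inv ≫ a ▷ 𝟙_ K ≫ (λ_ (𝟙_ K)).hom = a
  rw [unitors_equal, rightUnitor_naturality, ← unitors_equal, Iso.inv_hom_id_assoc]

namespace CentralIdempotent

variable (e : CentralIdempotent K)

lemma compl_app (X : K) : e.compl.app X = 𝟙 X - e.app X := rfl

/-- Idempotent completeness provides the summand `eX` of `X`, on which `e` acts as the identity. -/
lemma exists_split (X : K) : ∃ (Y : K) (i : Y ⟶ X) (p : X ⟶ Y),
    i ≫ p = 𝟙 Y ∧ p ≫ i = e.app X ∧ e.app Y = 𝟙 Y := by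
  obtain ⟨Y, i, p, h₁, h₂⟩ := IsIdempotentComplete.idempotents_split X (e.app X) (e.idem X)
  refine ⟨Y, i, p, h₁, h₂, ?_⟩
  rw [← Category.id_comp (e.app Y), ← h₁, Category.assoc, e.naturality, ← h₂, Category.assoc,
    h₁, Category.comp_id, h₁]

lemma proj_iso_of_comp {X Z : K} (u : X ⟶ Z) (v : Z ⟶ X) (h₁ : u ≫ v = e.app X)
    (h₂ : v ≫ u = e.app Z) : Nonempty (e.proj.obj Z ≅ e.proj.obj X) :=
  ⟨⟨e.proj.map v, e.proj.map u, by rw [← Functor.map_comp, h₂, e.map_app],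
    by rw [← Functor.map_comp, h₁, e.map_app]⟩⟩

instance : (e.proj.prod' e.compl.proj).Faithful where
  map_injective {X Y f g} h := by
    have h₁ := (e.map_proj_eq_iff f g).1 (congrArg Prod.fst h)
    have h₂ := (e.compl.map_proj_eq_iff f g).1 (congrArg Prod.snd h)
    rw [compl_app, Preadditive.comp_sub, Preadditive.comp_sub, h₁, Category.comp_id,
      Category.comp_id] at h₂
    exact sub_left_injective h₂

instance : (e.proj.prod' e.compl.proj).Full where
  map_surjective {X Y} := by
    rintro ⟨f, g⟩
    obtain ⟨f, rfl⟩ := e.proj.map_surjective f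
    obtain ⟨g, rfl⟩ := e.compl.proj.map_surjective g
    have h : e.app Y ≫ e.compl.app Y = 0 := by
      rw [compl_app, Preadditive.comp_sub, e.idem, Category.comp_id, sub_self]
    have h' : e.compl.app Y ≫ e.app Y = 0 := by
      rw [compl_app, Preadditive.sub_comp, e.idem, Category.id_comp, sub_self]
    -- The two lifts are glued by orthogonality of `e` and `1 - e`.
    refine ⟨f ≫ e.app Y + g ≫ e.compl.app Y, Prod.ext ?_ ?_⟩
    · refine (e.map_proj_eq_iff _ _).2 ?_
      rw [Preadditive.add_comp, Category.assoc, Category.assoc, e.idem, h', comp_zero, add_zero]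
    · refine (e.compl.map_proj_eq_iff _ _).2 ?_
      rw [Preadditive.add_comp, Category.assoc, Category.assoc, e.compl.idem, h, comp_zero,
        zero_add]

instance : (e.proj.prod' e.compl.proj).EssSurj where
  mem_essImage := by
    rintro ⟨⟨X⟩, ⟨Y⟩⟩
    -- The pair `(X, Y)` comes from `eX ⊞ (1 - e)Y`: each projection kills one summand and does not
    -- distinguish the other from the original object.
    obtain ⟨X', i, p, hip, hpi, hX⟩ := e.exists_split X
    obtain ⟨Y', j, q, hjq, hqj, hY⟩ := e.compl.exists_split Y
    have hX' : e.compl.app X' = 0 := by rw [compl_app, hX, sub_self]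
    have hY' : e.app Y' = 0 := by
      rw [compl_app] at hY
      simpa using hY
    have hZ : ∀ e : CentralIdempotent K, e.app (X' ⊞ Y') =
        biprod.fst ≫ e.app X' ≫ biprod.inl + biprod.snd ≫ e.app Y' ≫ biprod.inr := fun e => by
      rw [← Category.id_comp (e.app (X' ⊞ Y')), ← biprod.total, Preadditive.add_comp,
        Category.assoc, Category.assoc, e.naturality, e.naturality]
    obtain ⟨a⟩ := e.proj_iso_of_comp (X := X) (Z := X' ⊞ Y') (p ≫ biprod.inl) (biprod.fst ≫ i)
      (by simp [hpi]) (by rw [hZ, hX, hY']; simp [reassoc_of% hip])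
    obtain ⟨b⟩ := e.compl.proj_iso_of_comp (X := Y) (Z := X' ⊞ Y') (q ≫ biprod.inr)
      (biprod.snd ≫ j) (by simp [hqj]) (by rw [hZ, hY, hX']; simp [reassoc_of% hjq])
    exact ⟨X' ⊞ Y', ⟨Iso.prod a b⟩⟩

lemma isEquivalence_prod' : (e.proj.prod' e.compl.proj).IsEquivalence where

end CentralIdempotent

end TTFunctor

/-! ### The splitting in the rigid case -/

section Rigid

variable {K : Type u} [Category.{v} K] [Preadditive K] [HasZeroObject K] [HasShift K ℤ]
  [∀ n : ℤ, (shiftFunctor K n).Additive] [Pretriangulated K] [MonoidalCategory K]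
  [SymmetricCategory K] [TTCategory K]

/-- By the triangle identity for the dual `B`, the map `f` factors through `Z ⊗ B ⊗ A`, which
vanishes together with `A ⊗ Z`. -/
lemma eq_zero_of_isZero_tensor {A Z : K} (B : K) [ExactPairing A B] (h : IsZero (A ⊗ Z))
    (f : A ⟶ Z) : f = 0 := by
  have hZ : IsZero (Z ⊗ B ⊗ A) := by
    refine (isZero_tensor_left h B).of_iso ?_
    exact whiskerLeftIso Z (β_ B A) ≪≫ (α_ Z A B).symm ≪≫ whiskerRightIso (β_ Z A) B
  have hf : (λ_ A).hom ≫ f =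
      η_ A B ▷ A ≫ (α_ A B A).hom ≫ f ▷ (B ⊗ A) ≫ Z ◁ ε_ A B ≫ (ρ_ Z).hom := by
    rw [← whisker_exchange_assoc, rightUnitor_naturality]
    simp
  rw [← cancel_epi (λ_ A).hom, hf, hZ.eq_of_tgt (f ▷ (B ⊗ A)) 0]
  simp

lemma nonempty_iso_trivial {D : Type*} [Category* D] [MonoidalCategory D] (M : Mon D)
    (h : IsIso η[M.X]) : Nonempty (M ≅ Mon.trivial D) := by
  have := isMonHom_one M.X
  have : IsMonHom (asIso η[M.X]).hom := this
  exact ⟨(Mon.mkIso' (asIso η[M.X])).symm⟩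

/-- The map from `A` to the cone of `η` vanishes by duality, so the identity of `A` factors through
`η`; thus `A` is a summand of `𝟙`. -/
lemma exists_retraction_unit (A : K) [MonObj A] [IsIso μ[A]] (B : K) [ExactPairing A B] :
    ∃ s : A ⟶ 𝟙_ K, s ≫ η[A] = 𝟙 A := by
  obtain ⟨C, g, h, hT⟩ := distinguished_cocone_triangle η[A]
  have hg : g = 0 := eq_zero_of_isZero_tensor B (isZero_tensor_cone A hT) g
  obtain ⟨s, hs⟩ := Triangle.coyoneda_exact₂ _ hT (𝟙 A) (by
    change 𝟙 A ≫ g = 0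
    rw [hg, comp_zero])
  exact ⟨s, hs.symm⟩

lemma exists_splitting (A : K) [MonObj A] [IsIso μ[A]] (B : K) [ExactPairing A B] :
    ∃ (K₁ K₂ : TTCat.{v, u}) (F₁ : TTFunctor K K₁.carrier) (F₂ : TTFunctor K K₂.carrier),
      (F₁.functor.prod' F₂.functor).IsEquivalence ∧
      Nonempty (F₁.functor.mapMon.obj ⟨A⟩ ≅ Mon.trivial K₁.carrier) ∧
      IsZero (F₂.functor.obj A) := by
  obtain ⟨s, hs⟩ := exists_retraction_unit A B
  have ha : (η[A] ≫ s) ≫ η[A] ≫ s = η[A] ≫ s := by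
    rw [Category.assoc, reassoc_of% hs]
  let e := centralIdempotentOfUnit (η[A] ≫ s) ha
  have h₁ : e.app (𝟙_ K) = η[A] ≫ s := centralIdempotentOfUnit_app_unit _ ha
  -- Naturality along `η` transfers `e` from the unit to its summand `A`, which is exactly the part
  -- `e` cuts out. Hence `A` dies in the complementary quotient.
  have hA : e.app A = 𝟙 A := by
    have h := e.naturality η[A]
    rw [← Category.id_comp (e.app A), ← hs, Category.assoc, h, h₁, Category.assoc,
      reassoc_of% hs, hs]
  refine ⟨e.ttPart, e.compl.ttPart, e.ttProj, e.compl.ttProj, e.isEquivalence_prod', ?_, ?_⟩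
  -- The composite `s ≫ η` is already the identity, and `η ≫ s` is `e` on the unit, which the
  -- projection sends to the identity.
  · have : IsIso (e.proj.map η[A]) := by
      refine ⟨e.proj.map s, ?_, ?_⟩
      · rw [← Functor.map_comp, ← h₁, e.map_app]
      · rw [← Functor.map_comp, hs, CategoryTheory.Functor.map_id]
    apply nonempty_iso_trivial
    change IsIso (𝟙 (e.proj.obj (𝟙_ K)) ≫ e.proj.map η[A])
    infer_instance
  · change IsZero (e.compl.proj.obj A)
    rw [IsZero.iff_id_eq_zero, ← e.compl.map_app]
    change e.compl.proj.map (𝟙 A - e.app A) = 0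
    rw [hA, sub_self, Functor.map_zero]

end Rigid

end TT

theorem proposition4p1 {K : Type u} [Category.{v} K] [Preadditive K] [HasZeroObject K]
    [HasShift K ℤ] [∀ n : ℤ, (shiftFunctor K n).Additive] [Pretriangulated K]
    [MonoidalCategory K] [SymmetricCategory K] [TTCategory K]
    (A : CommMon K) (hA : TT.IsSeparable A.X) :
    (TT.HasDegree A 1 ↔ ¬ IsZero A.X ∧ IsIso μ[A.X]) ∧
    (IsIso μ[A.X] →
      TT.IsBousfieldLocalization (tensorLeft A.X) (TT.unitTrans A.X) ∧
      TT.IsVerdierLocalization (TT.freeFunctor A.X) (TT.modData A.X).dist ∧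
      IsClopen ((TT.selfData K).supp A.X) ∧
      (∃ h : (TT.modData A.X).Spc ≃ₜ (TT.selfData K).supp A.X,
        ∀ Q, (h Q).1.1 = Q.1.inverseImage (TT.freeFunctor A.X)) ∧
      ((∀ X : K, ∃ Y : K, Nonempty (ExactPairing X Y)) →
        ∃ (K₁ K₂ : TT.TTCat.{v, u}) (F₁ : TT.TTFunctor K K₁.carrier)
          (F₂ : TT.TTFunctor K K₂.carrier),
          (F₁.functor.prod' F₂.functor).IsEquivalence ∧
          Nonempty (F₁.functor.mapMon.obj A.toMon ≅ Mon.trivial K₁.carrier) ∧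
          IsZero (F₂.functor.obj A.X))) := by
  refine ⟨TT.hasDegree_one_iff A, fun _ => ⟨TT.isBousfieldLocalization A.X,
    TT.isVerdierLocalization A.X, TT.isClopen_supp A.X, ⟨TT.spcHomeomorph A.X, fun _ => rfl⟩,
    fun h => ?_⟩⟩
  obtain ⟨B, ⟨_⟩⟩ := h A.X
  exact TT.exists_splitting A.X B
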